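/- Let $K$ be a strict 2-category. A 1-arrow $f\colon x\to y$ is *ff* if $f_*\colon K(z,x)\to K(z,y)$ is fully faithful for every object $z$. A *strict 2-site* structure on $K$ is a class $\mathsf J$ of ff 1-arrows (called *covers*) which contains the identities and is closed under composition, together with a specified strict pullback of each $j\in\mathsf J$ along every 1-arrow with the same codomain, the pulled-back arrow again lying in $\mathsf J$, such that every $j\colon u\to x$ in $\mathsf J$ is strictly 2-regular: for all $f,g\colon x\to y$, every 2-arrow $fj\Rightarrow gj$ whose whiskerings with the two projections $u\times_x u\to u$ are equal is of the form $a\,j$ (the whiskering of $a$ with $j$) for a unique $a\colon f\Rightarrow g$. A *$\mathsf J$-fraction* from $x$ to $y$ is a span $x\xleftarrow{j}u\xrightarrow{f}y$ with $j\in\mathsf J$, denoted $(j,f)$. A *map of fractions* from $(j,f)$ to $(k,g)$, where $k\colon v\to x$, is a 2-arrow $f\circ\mathrm{pr}_1\Rightarrow g\circ\mathrm{pr}_2$ on $u\times_x v$. For maps $t_1\colon(j_1,f_1)\to(j_2,f_2)$ and $t_2\colon(j_2,f_2)\to(j_3,f_3)$, where $j_i\colon u_i\to x$, the composite is the unique 2-arrow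 on $u_1\times_x u_3$ whose whiskering with the cover $u_1\times_x u_2\times_x u_3\to u_1\times_x u_3$ is the composite of the whiskerings of $t_1$ and $t_2$ with the projections to $u_1\times_x u_2$ and $u_2\times_x u_3$. The identity of $(j,f)$ is the whiskering with $f$ of the unique 2-arrow $\mathrm{pr}_1\Rightarrow\mathrm{pr}_2\colon u\times_x u\to u$ whose whiskering with $j$ is an identity. Fractions from $x$ to $y$ and their maps form a category $K_{\mathsf J}(x,y)$, the hom-category of the bicategory of fractions $K_{\mathsf J}$, whose objects are those of $K$. Let $W_{\mathsf J}$ be the class of ff 1-arrows $q\colon x\to y$ for which there are a cover $j\colon u\to y$, a 1-arrow $s\colon u\to x$ and an invertible 2-arrow $q s\cong j$. A *localisation* of $K$ at $W_{\mathsf J}$ is a bicategory $L$ with a pseudofunctor $Q\colon K\to L$ sending $W_{\mathsf J}$ to equivalences such that, for every bicategory $A$, precomposition with $Q$ is a biequivalence from the bicategory $\mathbf{Bicat}(L,A)$ of pseudofunctors, pseudonatural transformations and modifications to the full sub-bicategory of $\mathbf{Bicat}(K,A)$ on the pseudofunctors sending $W_{\mathsf J}$ to equivalences. A bicategory is *locally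 essentially small* if each of its hom-categories is equivalent to a small category. **Proposition.** Suppose that $K$ is locally essentially small and that $(K,\mathsf J)$ satisfies WISC: every object $x$ has a set of covers $(p_i\colon c_i\to x)_{i\in I}$ such that for every cover $j\colon u\to x$ there are $i\in I$ and $a\colon c_i\to u$ with $j a=p_i$. Then $K_{\mathsf J}$ is locally essentially small, and every localisation of $K$ at $W_{\mathsf J}$ is locally essentially small. -/

import Mathlib

open CategoryTheory Bicategory

universe s w v u w' v' u'

namespace TwoSite

/-! ### Arrows in a strict 2-category -/

section Arrows

variable {K : Type u} [Bicategory.{w, v} K]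

/-- A class of 1-arrows of a bicategory. -/
abbrev ArrowClass (K : Type u) [Bicategory.{w, v} K] := ∀ ⦃x y : K⦄, (x ⟶ y) → Prop

/-- A 1-arrow `f : x ⟶ y` is (representably) fully faithful if for all `g h : z ⟶ x` whiskering
with `f` is a bijection from 2-arrows `g ⟶ h` to 2-arrows `g ≫ f ⟶ h ≫ f`. -/
def IsFF {x y : K} (f : x ⟶ y) : Prop :=
  ∀ ⦃z : K⦄ (g h : z ⟶ x), Function.Bijective (fun a : g ⟶ h => a ▷ f)

/-- A 1-arrow is an equivalence if it has a pseudo-inverse. -/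
def IsEquiv {x y : K} (f : x ⟶ y) : Prop :=
  ∃ g : y ⟶ x, Nonempty (f ≫ g ≅ 𝟙 x) ∧ Nonempty (g ≫ f ≅ 𝟙 y)

/-- A bicategory is locally essentially small if all its hom-categories are equivalent to small
categories. -/
def LocallyEssentiallySmall (K : Type u) [Bicategory.{w, v} K] : Prop :=
  ∀ x y : K, EssentiallySmall.{s} (x ⟶ y)

/-- Let `p₁ p₂ : r ⟶ u` be the kernel pair of `p : u ⟶ x`. Then `p` is strictly 2-regular if
every 2-arrow `b : p ≫ f ⟶ p ≫ g` whose whiskerings with `p₁` and `p₂` agree is of the form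
`p ◁ a` for a unique `a : f ⟶ g`. The 2-arrows `eqToHom _` only identify the equal 1-arrows
`p₁ ≫ p ≫ f` and `p₂ ≫ p ≫ f`. In other words, precomposition with `p` is fully faithful as a
functor into strict descent data. -/
def IsStrictlyTwoRegular [Bicategory.Strict K] {u x r : K} (p : u ⟶ x) (p₁ p₂ : r ⟶ u)
    (h : p₁ ≫ p = p₂ ≫ p) : Prop :=
  ∀ ⦃y : K⦄ (f g : x ⟶ y) (b : p ≫ f ⟶ p ≫ g),
    p₁ ◁ b ≫ eqToHom (by rw [← Strict.assoc, h, Strict.assoc]) =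
      eqToHom (by rw [← Strict.assoc, h, Strict.assoc]) ≫ p₂ ◁ b →
    ∃! a : f ⟶ g, p ◁ a = b

end Arrows

/-! ### Localisations of bicategories -/

section Localisation

open scoped Pseudofunctor.StrongTrans

universe w₁ v₁ u₁ w₂ v₂ u₂ w₃ v₃ u₃

/-- A pseudofunctor is a biequivalence if it is surjective on objects up to equivalence and
induces equivalences of hom-categories. -/
def IsBiequivalence {B : Type u₁} [Bicategory.{w₁, v₁} B] {C : Type u₂} [Bicategory.{w₂, v₂} C]
    (F : B ⥤ᵖ C) : Prop :=
  (∀ c : C, ∃ b : B, Nonempty (F.obj b ≌ c)) ∧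
    ∀ a b : B, (F.mapFunctor a b).IsEquivalence

variable {B : Type u₁} [Bicategory.{w₁, v₁} B] {L : Type u₂} [Bicategory.{w₂, v₂} L]

/-- The pseudofunctor `F` sends the arrows in `W` to equivalences. -/
def Inverts (W : ArrowClass B) (F : B ⥤ᵖ L) : Prop :=
  ∀ ⦃x y : B⦄ (f : x ⟶ y), W f → IsEquiv (F.map f)

theorem IsEquiv.map {x y : B} {f : x ⟶ y} (hf : IsEquiv f) (F : B ⥤ᵖ L) :
    IsEquiv (F.map f) := by
  obtain ⟨g, ⟨e⟩, ⟨e'⟩⟩ := hf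
  exact ⟨F.map g, ⟨(F.mapComp f g).symm ≪≫ F.map₂Iso e ≪≫ F.mapId x⟩,
    ⟨(F.mapComp g f).symm ≪≫ F.map₂Iso e' ≪≫ F.mapId y⟩⟩

theorem Inverts.comp {W : ArrowClass B} {Q : B ⥤ᵖ L} (hQ : Inverts W Q)
    {A : Type u₃} [Bicategory.{w₃, v₃} A] (G : L ⥤ᵖ A) : Inverts W (Q.comp G) :=
  fun _ _ f hf => (hQ f hf).map G

/-- The full sub-bicategory of the bicategory of pseudofunctors, pseudonatural transformations
and modifications from `B` to `A`, on the pseudofunctors sending `W` to equivalences. -/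
abbrev BicatInverting (W : ArrowClass B) (A : Type u₃) [Bicategory.{w₃, v₃} A] :=
  InducedBicategory (B ⥤ᵖ A) (fun F : {F : B ⥤ᵖ A // Inverts W F} => F.1)

/-- Precomposition of a pseudonatural transformation with a pseudofunctor. -/
@[simps]
def precompTrans (Q : B ⥤ᵖ L) {A : Type u₃} [Bicategory.{w₃, v₃} A] {G H : L ⥤ᵖ A} (η : G ⟶ H) :
    Q.comp G ⟶ Q.comp H where
  app x := η.app (Q.obj x)
  naturality f := η.naturality (Q.map f)
  naturality_naturality a := η.naturality_naturality (Q.map₂ a)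
  naturality_id x := by
    change (η.naturality (Q.map (𝟙 x))).hom ≫
        η.app (Q.obj x) ◁ (H.map₂ (Q.mapId x).hom ≫ (H.mapId (Q.obj x)).hom) =
      (G.map₂ (Q.mapId x).hom ≫ (G.mapId (Q.obj x)).hom) ▷ η.app (Q.obj x) ≫
        (λ_ (η.app (Q.obj x))).hom ≫ (ρ_ (η.app (Q.obj x))).inv
    rw [whiskerLeft_comp, comp_whiskerRight, Category.assoc, ← η.naturality_id,
      ← η.naturality_naturality_assoc]
  naturality_comp {a b c} f g := by
    change (η.naturality (Q.map (f ≫ g))).hom ≫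
        η.app (Q.obj a) ◁ (H.map₂ (Q.mapComp f g).hom ≫ (H.mapComp (Q.map f) (Q.map g)).hom) =
      (G.map₂ (Q.mapComp f g).hom ≫ (G.mapComp (Q.map f) (Q.map g)).hom) ▷ η.app (Q.obj c) ≫
        (α_ _ _ _).hom ≫ G.map (Q.map f) ◁ (η.naturality (Q.map g)).hom ≫
        (α_ _ _ _).inv ≫ (η.naturality (Q.map f)).hom ▷ H.map (Q.map g) ≫ (α_ _ _ _).hom
    rw [whiskerLeft_comp, comp_whiskerRight, Category.assoc, ← η.naturality_comp,
      ← η.naturality_naturality_assoc]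

/-- Precomposition of a modification with a pseudofunctor. -/
@[simps]
def precompModif (Q : B ⥤ᵖ L) {A : Type u₃} [Bicategory.{w₃, v₃} A] {G H : L ⥤ᵖ A}
    {η θ : G ⟶ H} (Γ : η ⟶ θ) : precompTrans Q η ⟶ precompTrans Q θ where
  as :=
    { app x := Γ.as.app (Q.obj x)
      naturality f := Γ.as.naturality (Q.map f) }

/-- Precomposition preserves identities. -/
def precompId (Q : B ⥤ᵖ L) {A : Type u₃} [Bicategory.{w₃, v₃} A] (G : L ⥤ᵖ A) :
    precompTrans Q (𝟙 G) ≅ 𝟙 (Q.comp G) :=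
  Pseudofunctor.StrongTrans.isoMk (fun _ => Iso.refl _) (fun {a b} f => by
    change _ ◁ 𝟙 _ ≫ ((𝟙 G : G ⟶ G).naturality (Q.map f)).hom = ((𝟙 G : G ⟶ G).naturality (Q.map f)).hom ≫ 𝟙 _ ▷ _
    rw [whiskerLeft_id, id_whiskerRight, Category.id_comp, Category.comp_id])

/-- Precomposition preserves composition. -/
def precompComp (Q : B ⥤ᵖ L) {A : Type u₃} [Bicategory.{w₃, v₃} A] {G H I : L ⥤ᵖ A}
    (η : G ⟶ H) (θ : H ⟶ I) :
    precompTrans Q (η ≫ θ) ≅ precompTrans Q η ≫ precompTrans Q θ :=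
  Pseudofunctor.StrongTrans.isoMk (fun _ => Iso.refl _) (fun {a b} f => by
    change _ ◁ 𝟙 _ ≫ ((η ≫ θ).naturality (Q.map f)).hom = ((η ≫ θ).naturality (Q.map f)).hom ≫ 𝟙 _ ▷ _
    rw [whiskerLeft_id, id_whiskerRight, Category.id_comp, Category.comp_id])

/-- Precomposition with a pseudofunctor `Q` inverting `W`, as a pseudofunctor. -/
def precomposition {W : ArrowClass B} {Q : B ⥤ᵖ L} (hQ : Inverts W Q)
    (A : Type u₃) [Bicategory.{w₃, v₃} A] : (L ⥤ᵖ A) ⥤ᵖ BicatInverting W A where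
  obj G := ⟨Q.comp G, hQ.comp G⟩
  map η := InducedBicategory.mkHom (precompTrans Q η)
  map₂ Γ := ⟨precompModif Q Γ⟩
  mapId G := InducedBicategory.isoMk (precompId Q G)
  mapComp η θ := InducedBicategory.isoMk (precompComp Q η θ)
  map₂_id _ := rfl
  map₂_comp _ _ := rfl
  map₂_whisker_left η θ ι Γ := by
    apply InducedBicategory.hom₂_ext
    apply Pseudofunctor.StrongTrans.homCategory.ext
    intro x
    change η.app (Q.obj x) ◁ Γ.as.app (Q.obj x) =
      𝟙 _ ≫ η.app (Q.obj x) ◁ Γ.as.app (Q.obj x) ≫ 𝟙 _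
    rw [Category.comp_id, Category.id_comp]
  map₂_whisker_right Γ η := by
    apply InducedBicategory.hom₂_ext
    apply Pseudofunctor.StrongTrans.homCategory.ext
    intro x
    change Γ.as.app (Q.obj x) ▷ η.app (Q.obj x) =
      𝟙 _ ≫ Γ.as.app (Q.obj x) ▷ η.app (Q.obj x) ≫ 𝟙 _
    rw [Category.comp_id, Category.id_comp]
  map₂_associator η θ ι := by
    apply InducedBicategory.hom₂_ext
    apply Pseudofunctor.StrongTrans.homCategory.ext
    intro x
    change (α_ (η.app (Q.obj x)) (θ.app (Q.obj x)) (ι.app (Q.obj x))).hom =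
      𝟙 _ ≫ 𝟙 _ ▷ _ ≫ (α_ (η.app (Q.obj x)) (θ.app (Q.obj x)) (ι.app (Q.obj x))).hom ≫
        _ ◁ 𝟙 _ ≫ 𝟙 _
    simp
  map₂_left_unitor η := by
    apply InducedBicategory.hom₂_ext
    apply Pseudofunctor.StrongTrans.homCategory.ext
    intro x
    change (λ_ (η.app (Q.obj x))).hom = 𝟙 _ ≫ 𝟙 _ ▷ _ ≫ (λ_ (η.app (Q.obj x))).hom
    simp
  map₂_right_unitor η := by
    apply InducedBicategory.hom₂_ext
    apply Pseudofunctor.StrongTrans.homCategory.ext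
    intro x
    change (ρ_ (η.app (Q.obj x))).hom = 𝟙 _ ≫ _ ◁ 𝟙 _ ≫ (ρ_ (η.app (Q.obj x))).hom
    simp

/-- `Q` is a localisation of `B` at `W`: it sends `W` to equivalences, and for every bicategory
`A` precomposition with `Q` is a biequivalence onto the bicategory of pseudofunctors `B ⥤ᵖ A`
sending `W` to equivalences. The first three universe levels are those of `A`: objects, 1-arrows
and 2-arrows. -/
def IsLocalisation.{a₁, a₂, a₃, b₁, b₂, b₃, c₁, c₂, c₃} {B : Type b₁} [Bicategory.{b₃, b₂} B]
    {L : Type c₁} [Bicategory.{c₃, c₂} L] (W : ArrowClass B) (Q : B ⥤ᵖ L) : Prop :=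
  ∃ hQ : Inverts W Q, ∀ (A : Type a₁) [Bicategory.{a₃, a₂} A],
    IsBiequivalence (precomposition hQ A)

end Localisation

/-! ### Strict 2-sites -/

/-- A singleton strict pretopology: a class of 1-arrows containing the identities, closed under
composition, with specified strict pullbacks of its elements along arbitrary 1-arrows, which are
again elements. -/
structure StrictPretopology (K : Type u) [Bicategory.{w, v} K] [Bicategory.Strict K] where
  /-- the covers -/
  J : ArrowClass K
  id_mem (x : K) : J (𝟙 x)
  comp_mem {x y z : K} (f : x ⟶ y) (g : y ⟶ z) : J f → J g → J (f ≫ g)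
  /-- the specified pullback of the cover `j` along `f` -/
  pb {u x y : K} (j : u ⟶ x) (hj : J j) (f : y ⟶ x) : K
  /-- the projection to the domain of the cover -/
  fst {u x y : K} (j : u ⟶ x) (hj : J j) (f : y ⟶ x) : pb j hj f ⟶ u
  /-- the projection to the domain of the other arrow -/
  snd {u x y : K} (j : u ⟶ x) (hj : J j) (f : y ⟶ x) : pb j hj f ⟶ y
  isPullback {u x y : K} (j : u ⟶ x) (hj : J j) (f : y ⟶ x) :
    IsPullback (fst j hj f) (snd j hj f) j f
  snd_mem {u x y : K} (j : u ⟶ x) (hj : J j) (f : y ⟶ x) : J (snd j hj f)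

/-- A strict 2-site structure on a strict 2-category: a totally strict subcanonical singleton
pretopology all of whose elements are fully faithful. -/
structure StrictTwoSite (K : Type u) [Bicategory.{w, v} K] [Bicategory.Strict K] extends
    StrictPretopology K where
  subcanonical {u x : K} (j : u ⟶ x) (hj : J j) :
    IsStrictlyTwoRegular j (fst j hj j) (snd j hj j) (isPullback j hj j).w
  ff {u x : K} (j : u ⟶ x) : J j → IsFF j

variable {K : Type u} [Bicategory.{w, v} K] [Bicategory.Strict K]

/-- The condition WISC: every object has a small set of covers that is weakly initial among all
its covers. -/
def WISC (S : StrictTwoSite K) : Prop :=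
  ∀ x : K, ∃ (I : Type s) (c : I → K) (p : ∀ i, c i ⟶ x), (∀ i, S.J (p i)) ∧
    ∀ (u : K) (j : u ⟶ x), S.J j → ∃ (i : I) (a : c i ⟶ u), a ≫ j = p i

/-- `q : x ⟶ y` is locally split if some cover `u ⟶ y` lifts through `q` up to an invertible
2-arrow. -/
def IsLocallySplit (S : StrictTwoSite K) {x y : K} (q : x ⟶ y) : Prop :=
  ∃ (u : K) (j : u ⟶ y) (r : u ⟶ x), S.J j ∧ Nonempty (r ≫ q ≅ j)

/-- The class `W_J` of weak equivalences: the locally split fully faithful arrows. -/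
def weakEquivalences (S : StrictTwoSite K) : ArrowClass K :=
  fun _ _ q => IsFF q ∧ IsLocallySplit S q

/-! ### Canonical 2-arrows and descent -/

section Cells

attribute [local simp] Strict.associator_eqToIso Strict.leftUnitor_eqToIso
  Strict.rightUnitor_eqToIso

/-- The unique 2-arrow between two lifts of the same arrow through a fully faithful arrow. -/
noncomputable def canon {w u x : K} {j : u ⟶ x} (hj : IsFF j) {a b : w ⟶ u}
    (h : a ≫ j = b ≫ j) : a ⟶ b :=
  ((hj a b).2 (eqToHom h)).choose

theorem canon_whisker {w u x : K} {j : u ⟶ x} (hj : IsFF j) {a b : w ⟶ u}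
    (h : a ≫ j = b ≫ j) : canon hj h ▷ j = eqToHom h :=
  ((hj a b).2 (eqToHom h)).choose_spec

theorem canon_unique {w u x : K} {j : u ⟶ x} (hj : IsFF j) {a b : w ⟶ u}
    {h : a ≫ j = b ≫ j} (c : a ⟶ b) (hc : c ▷ j = eqToHom h) : c = canon hj h :=
  (hj a b).1 (hc.trans (canon_whisker hj h).symm)

theorem canon_refl {w u x : K} {j : u ⟶ x} (hj : IsFF j) {a : w ⟶ u} (h : a ≫ j = a ≫ j) :
    canon hj h = 𝟙 a :=
  (canon_unique hj (h := h) (𝟙 a) (by simp)).symm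

theorem canon_precomp {w' w u x : K} {j : u ⟶ x} (hj : IsFF j) {a b : w ⟶ u}
    (h : a ≫ j = b ≫ j) (c : w' ⟶ w) (h' : (c ≫ a) ≫ j = (c ≫ b) ≫ j) :
    c ◁ canon hj h = canon hj h' := by
  apply canon_unique
  simp [canon_whisker]

/-- Covers satisfy descent for arbitrary 2-arrows. -/
theorem descent (S : StrictTwoSite K) {u x y : K} {j : u ⟶ x} (hj : S.J j) {f g : x ⟶ y}
    (b : j ≫ f ⟶ j ≫ g) : ∃! a : f ⟶ g, j ◁ a = b := by
  apply S.subcanonical j hj f g b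
  have hw := (S.isPullback j hj j).w
  have h := whisker_exchange (canon (S.ff j hj) hw) b
  have e : ∀ k : x ⟶ y, canon (S.ff j hj) hw ▷ (j ≫ k) =
      eqToHom (by rw [← Strict.assoc, hw, Strict.assoc]) := by
    intro k
    have := canon_whisker (S.ff j hj) hw
    simp [whiskerRight_comp, this]
  rw [e, e] at h
  exact h

end Cells

/-! ### Fractions -/

/-- A fraction from `x` to `y`: a span `x ⟵ u ⟶ y` whose left leg is a cover. -/
structure Fraction (S : StrictTwoSite K) (x y : K) where
  /-- the vertex `u` -/
  obj : K
  /-- the left leg -/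
  left : obj ⟶ x
  mem : S.J left
  /-- the right leg -/
  right : obj ⟶ y

namespace Fraction

variable {S : StrictTwoSite K} {x y : K}

/-- The specified pullback `u ×ₓ v` of the left legs of two fractions. -/
abbrev P (A B : Fraction S x y) : K := S.pb A.left A.mem B.left

/-- The projection `u ×ₓ v ⟶ u`. -/
abbrev p₁ (A B : Fraction S x y) : P A B ⟶ A.obj := S.fst A.left A.mem B.left

/-- The projection `u ×ₓ v ⟶ v`. -/
abbrev p₂ (A B : Fraction S x y) : P A B ⟶ B.obj := S.snd A.left A.mem B.left

theorem w (A B : Fraction S x y) : p₁ A B ≫ A.left = p₂ A B ≫ B.left :=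
  (S.isPullback A.left A.mem B.left).w

/-- A map of fractions `(j, f) ⟶ (k, g)`: a 2-arrow from `u ×ₓ v ⟶ u ⟶ y` to
`u ×ₓ v ⟶ v ⟶ y`. -/
@[ext]
structure Hom (A B : Fraction S x y) where
  /-- the underlying 2-arrow -/
  cell : p₁ A B ≫ A.right ⟶ p₂ A B ≫ B.right

section

attribute [local simp] Strict.associator_eqToIso Strict.leftUnitor_eqToIso
  Strict.rightUnitor_eqToIso

variable {A B C D : Fraction S x y}

/-- The arrow `z ⟶ u ×ₓ v` with components `a` and `b`. -/
noncomputable def pair {z : K} (a : z ⟶ A.obj) (b : z ⟶ B.obj) (h : a ≫ A.left = b ≫ B.left) :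
    z ⟶ P A B :=
  (S.isPullback A.left A.mem B.left).lift a b h

theorem pair_p₁ {z : K} (a : z ⟶ A.obj) (b : z ⟶ B.obj) (h : a ≫ A.left = b ≫ B.left) :
    pair a b h ≫ p₁ A B = a :=
  (S.isPullback A.left A.mem B.left).lift_fst a b h

theorem pair_p₂ {z : K} (a : z ⟶ A.obj) (b : z ⟶ B.obj) (h : a ≫ A.left = b ≫ B.left) :
    pair a b h ≫ p₂ A B = b :=
  (S.isPullback A.left A.mem B.left).lift_snd a b h

/-- The whiskering of a map of fractions with the arrow `z ⟶ u ×ₓ v` with components `a`, `b`. -/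
noncomputable def Hom.app (t : Hom A B) {z : K} (a : z ⟶ A.obj) (b : z ⟶ B.obj)
    (h : a ≫ A.left = b ≫ B.left) : a ≫ A.right ⟶ b ≫ B.right :=
  eqToHom (by rw [← Strict.assoc, pair_p₁]) ≫ pair a b h ◁ t.cell ≫
    eqToHom (by rw [← Strict.assoc, pair_p₂])

theorem Hom.app_eq (t : Hom A B) {z : K} (a : z ⟶ A.obj) (b : z ⟶ B.obj)
    (h : a ≫ A.left = b ≫ B.left) (l : z ⟶ P A B) (ha : l ≫ p₁ A B = a) (hb : l ≫ p₂ A B = b) :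
    t.app a b h = eqToHom (by rw [← Strict.assoc, ha]) ≫ l ◁ t.cell ≫
      eqToHom (by rw [← Strict.assoc, hb]) := by
  have : l = pair a b h := by
    apply (S.isPullback A.left A.mem B.left).hom_ext
    · exact ha.trans (pair_p₁ a b h).symm
    · exact hb.trans (pair_p₂ a b h).symm
  subst this
  rfl

theorem Hom.app_self (t : Hom A B) : t.app (p₁ A B) (p₂ A B) (w A B) = t.cell := by
  rw [t.app_eq _ _ _ (𝟙 _) (Strict.id_comp _) (Strict.id_comp _)]
  simp [id_whiskerLeft]

theorem Hom.app_precomp (t : Hom A B) {z' z : K} (c : z' ⟶ z) (a : z ⟶ A.obj) (b : z ⟶ B.obj)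
    (h : a ≫ A.left = b ≫ B.left) (h' : (c ≫ a) ≫ A.left = (c ≫ b) ≫ B.left) :
    t.app (c ≫ a) (c ≫ b) h' =
      eqToHom (Strict.assoc _ _ _) ≫ c ◁ t.app a b h ≫ eqToHom (Strict.assoc _ _ _).symm := by
  rw [t.app_eq a b h (pair a b h) (pair_p₁ a b h) (pair_p₂ a b h),
    t.app_eq (c ≫ a) (c ≫ b) h' (c ≫ pair a b h) (by rw [Strict.assoc, pair_p₁])
      (by rw [Strict.assoc, pair_p₂])]
  simp [comp_whiskerLeft]

theorem Hom.app_precomp' (t : Hom A B) {z' z : K} (c : z' ⟶ z) (a : z ⟶ A.obj) (b : z ⟶ B.obj)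
    (h : a ≫ A.left = b ≫ B.left) (a' : z' ⟶ A.obj) (b' : z' ⟶ B.obj)
    (h' : a' ≫ A.left = b' ≫ B.left) (ha : c ≫ a = a') (hb : c ≫ b = b') :
    t.app a' b' h' = eqToHom (by rw [← ha, Strict.assoc]) ≫ c ◁ t.app a b h ≫
      eqToHom (by rw [← hb, Strict.assoc]) := by
  subst ha hb
  exact t.app_precomp c a b h h'

/-- A map of fractions is determined by its whiskering with any cover. -/
theorem Hom.ext_of_cover {t t' : Hom A B} {z : K} (q : z ⟶ P A B) (hq : S.J q)
    (e : t.app (q ≫ p₁ A B) (q ≫ p₂ A B) (by rw [Strict.assoc, Strict.assoc, w]) =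
      t'.app (q ≫ p₁ A B) (q ≫ p₂ A B) (by rw [Strict.assoc, Strict.assoc, w])) : t = t' := by
  rw [t.app_precomp q _ _ (w A B), t'.app_precomp q _ _ (w A B)] at e
  simp only [Hom.app_self, cancel_epi, cancel_mono] at e
  exact Hom.ext ((descent S hq (q ◁ t'.cell)).unique e rfl)

variable (A B C) in
/-- The triple pullback `v ×ₓ (u ×ₓ w)` of the left legs of three fractions. -/
abbrev T : K := S.pb B.left B.mem (p₁ A C ≫ A.left)

variable (A B C) in
/-- The projection `v ×ₓ (u ×ₓ w) ⟶ u ×ₓ w`, which is a cover. -/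
abbrev p₁₃ : T A B C ⟶ P A C := S.snd B.left B.mem (p₁ A C ≫ A.left)

variable (A B C) in
/-- The projection `v ×ₓ (u ×ₓ w) ⟶ v`. -/
abbrev pm : T A B C ⟶ B.obj := S.fst B.left B.mem (p₁ A C ≫ A.left)

theorem w₁ (A B C : Fraction S x y) : (p₁₃ A B C ≫ p₁ A C) ≫ A.left = pm A B C ≫ B.left := by
  rw [Strict.assoc]
  exact (S.isPullback B.left B.mem (p₁ A C ≫ A.left)).w.symm

theorem w₃ (A B C : Fraction S x y) : pm A B C ≫ B.left = (p₁₃ A B C ≫ p₂ A C) ≫ C.left := by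
  rw [← w₁, Strict.assoc, Strict.assoc, w]

/-- The precomposition of two maps of fractions, a 2-arrow on the triple pullback. -/
noncomputable def precomp (t : Hom A B) (t' : Hom B C) :
    p₁₃ A B C ≫ p₁ A C ≫ A.right ⟶ p₁₃ A B C ≫ p₂ A C ≫ C.right :=
  eqToHom (Strict.assoc _ _ _).symm ≫ t.app _ _ (w₁ A B C) ≫ t'.app _ _ (w₃ A B C) ≫
    eqToHom (Strict.assoc _ _ _)

/-- The composition of maps of fractions: the unique descent of their precomposition along the
cover `p₁₃`. -/
noncomputable def comp (t : Hom A B) (t' : Hom B C) : Hom A C where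
  cell := (descent S (S.snd_mem B.left B.mem (p₁ A C ≫ A.left)) (precomp t t')).choose

theorem comp_spec (t : Hom A B) (t' : Hom B C) :
    p₁₃ A B C ◁ (comp t t').cell = precomp t t' :=
  (descent S (S.snd_mem B.left B.mem (p₁ A C ≫ A.left)) (precomp t t')).choose_spec.1

/-- The identity map of a fraction: the canonical 2-arrow `p₁ ⟶ p₂` followed by the right leg. -/
noncomputable def id (A : Fraction S x y) : Hom A A where
  cell := canon (S.ff _ A.mem) (w A A) ▷ A.right

theorem id_app {z : K} (a b : z ⟶ A.obj) (h : a ≫ A.left = b ≫ A.left) :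
    (id A).app a b h = canon (S.ff _ A.mem) h ▷ A.right := by
  obtain ⟨l, rfl, rfl⟩ : ∃ l : z ⟶ P A A, l ≫ p₁ A A = a ∧ l ≫ p₂ A A = b :=
    ⟨_, pair_p₁ a b h, pair_p₂ a b h⟩
  rw [Hom.app_precomp _ l _ _ (w A A), Hom.app_self, ← canon_precomp _ (w A A)]
  simp [id]

theorem comp_app (t : Hom A B) (t' : Hom B C) {z : K} (a : z ⟶ A.obj) (b : z ⟶ B.obj)
    (c : z ⟶ C.obj) (h : a ≫ A.left = b ≫ B.left) (h' : b ≫ B.left = c ≫ C.left) :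
    (comp t t').app a c (h.trans h') = t.app a b h ≫ t'.app b c h' := by
  obtain ⟨l, rfl, rfl⟩ : ∃ l : z ⟶ P A C, l ≫ p₁ A C = a ∧ l ≫ p₂ A C = c :=
    ⟨_, pair_p₁ a c (h.trans h'), pair_p₂ a c (h.trans h')⟩
  obtain ⟨r, rfl, rfl⟩ : ∃ r : z ⟶ T A B C, r ≫ pm A B C = b ∧ r ≫ p₁₃ A B C = l :=
    ⟨(S.isPullback B.left B.mem (p₁ A C ≫ A.left)).lift b l
      (by rw [← h]; exact Strict.assoc _ _ _),
      (S.isPullback _ _ _).lift_fst _ _ _, (S.isPullback _ _ _).lift_snd _ _ _⟩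
  rw [(comp t t').app_precomp' r (p₁₃ A B C ≫ p₁ A C) (p₁₃ A B C ≫ p₂ A C)
      ((w₁ A B C).trans (w₃ A B C)) _ _ _ (Strict.assoc _ _ _).symm (Strict.assoc _ _ _).symm,
    (comp t t').app_precomp (p₁₃ A B C) _ _ (w A C), Hom.app_self, comp_spec, precomp,
    t.app_precomp' r _ _ (w₁ A B C) _ _ h (Strict.assoc _ _ _).symm rfl,
    t'.app_precomp' r _ _ (w₃ A B C) _ _ h' rfl (Strict.assoc _ _ _).symm]
  simp

/-- The category `K_J(x, y)`, the hom-category from `x` to `y` of the bicategory of fractions: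
its objects are the fractions from `x` to `y`, its arrows are the maps of fractions. -/
noncomputable instance category : Category (Fraction S x y) where
  Hom := Hom
  id := id
  comp := comp
  id_comp {A B} t := by
    apply Hom.ext_of_cover (𝟙 _) (S.id_mem _)
    have h : (𝟙 _ ≫ p₁ A B) ≫ A.left = (𝟙 _ ≫ p₂ A B) ≫ B.left := by
      rw [Strict.assoc, Strict.assoc, w]
    rw [comp_app (id A) t _ _ _ rfl h, id_app, canon_refl]
    simp
  comp_id {A B} t := by
    apply Hom.ext_of_cover (𝟙 _) (S.id_mem _)
    have h : (𝟙 _ ≫ p₁ A B) ≫ A.left = (𝟙 _ ≫ p₂ A B) ≫ B.left := by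
      rw [Strict.assoc, Strict.assoc, w]
    rw [comp_app t (id B) _ _ _ h rfl, id_app, canon_refl]
    simp
  assoc {A B C D} t₁ t₂ t₃ := by
    let f := p₁₃ A B D ≫ p₁ A D ≫ A.left
    let r := S.snd C.left C.mem f
    have hc : (r ≫ pm A B D) ≫ B.left = S.fst C.left C.mem f ≫ C.left := by
      rw [(S.isPullback C.left C.mem f).w, Strict.assoc, ← w₁, Strict.assoc]
    have ha : ((r ≫ p₁₃ A B D) ≫ p₁ A D) ≫ A.left = (r ≫ pm A B D) ≫ B.left := by
      rw [Strict.assoc r (pm A B D), ← w₁]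
      simp only [Strict.assoc]
    have hd : S.fst C.left C.mem f ≫ C.left = ((r ≫ p₁₃ A B D) ≫ p₂ A D) ≫ D.left := by
      rw [← hc, ← ha]
      simp only [Strict.assoc, w]
    apply Hom.ext_of_cover (r ≫ p₁₃ A B D) (S.comp_mem _ _ (S.snd_mem _ _ _) (S.snd_mem _ _ _))
    rw [comp_app (comp t₁ t₂) t₃ _ _ _ (ha.trans hc) hd, comp_app t₁ t₂ _ _ _ ha hc,
      comp_app t₁ (comp t₂ t₃) _ _ _ ha (hc.trans hd), comp_app t₂ t₃ _ _ _ hc hd]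
    exact Category.assoc _ _ _

end

end Fraction

/-- The bicategory of fractions `K_J` is locally essentially small: its objects are the objects of
`K`, and its hom-categories are the categories of fractions and maps of fractions. -/
def FractionsLocallyEssentiallySmall (S : StrictTwoSite K) : Prop :=
  ∀ x y : K, EssentiallySmall.{s} (Fraction S x y)

end TwoSite

/-!
By WISC, a cover can be refined to one of the chosen covers `p i`, and a fraction is isomorphic to
its restriction along such a refinement. The chosen left legs and representatives of the right legs
up to isomorphism thus give a small set of representatives of the fractions, while maps of
fractions are particular 2-arrows of `K`.

A localisation `Q : K ⥤ᵖ L` is only known through its universal property. The bicategory of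
zigzags in `K`, with those 2-arrows of `L` that correspond to 2-arrows of `K` over some cover, also
inverts the weak equivalences, and every zigzag can be presented by a fraction, so that it is
locally essentially small for the same reason. The universal property extends the pseudofunctor
from `K` to zigzags to one on `L`; composed with the forgetful pseudofunctor back to `L`, it
restricts along `Q` to `Q` up to equivalence. The universal property, applied once more, makes the
identity of `L` a pseudoretract of this composite, so that the hom-categories of `L` are retracts
of hom-categories of zigzags.
-/

namespace TwoSite

section EssentiallySmall

universe v₁ u₁ v₂ u₂ t

variable {C : Type u₁} [Category.{v₁} C]

theorem essentiallySmall_of_representatives [LocallySmall.{s} C] {T : Type t} [Small.{s} T]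
    (r : T → C) (hr : ∀ X, ∃ t, Nonempty (r t ≅ X)) : EssentiallySmall.{s} C := by
  refine (essentiallySmall_iff C).2
    ⟨small_of_surjective (f := fun t => toSkeleton (r t)) fun X => ?_, inferInstance⟩
  obtain ⟨t, ⟨e⟩⟩ := hr ((fromSkeleton C).obj X)
  exact ⟨t, (toSkeleton_eq_toSkeleton_iff.2 ⟨e⟩).trans (toSkeleton_fromSkeleton_obj X)⟩

theorem essentiallySmall_of_retract {D : Type u₂} [Category.{v₂} D] [EssentiallySmall.{s} D]
    (G : C ⥤ D) (R : D ⥤ C) (e : G ⋙ R ≅ 𝟭 C) : EssentiallySmall.{s} C := by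
  have : G.Faithful := Functor.Faithful.of_comp_iso e
  have : LocallySmall.{s} C := locallySmall_of_faithful G
  refine essentiallySmall_of_representatives (fun X : Skeleton D => R.obj ((fromSkeleton D).obj X))
    fun X => ⟨toSkeleton (G.obj X), ⟨R.mapIso (fromSkeletonToSkeletonIso _) ≪≫ e.app X⟩⟩

end EssentiallySmall

namespace IsEquiv

variable {L : Type u'} [Bicategory.{w', v'} L] {x y z : L} {f : x ⟶ y}

theorem isEquivalence_precomp (hf : IsEquiv f) (z : L) : (precomp z f).IsEquivalence := by
  obtain ⟨g, ⟨e⟩, ⟨e'⟩⟩ := hf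
  exact (CategoryTheory.Equivalence.mk (precomp z f) (precomp z g)
    ((leftUnitorNatIso y z).symm ≪≫ (precomposing y y z).mapIso e'.symm ≪≫
      associatorNatIsoRight g f z)
    ((associatorNatIsoRight f g z).symm ≪≫ (precomposing x x z).mapIso e ≪≫
      leftUnitorNatIso x z)).isEquivalence_functor

theorem whiskerLeft_injective (hf : IsEquiv f) (g h : y ⟶ z) :
    Function.Injective (fun a : g ⟶ h => f ◁ a) :=
  have := hf.isEquivalence_precomp z
  (precomp z f).map_injective

theorem nonempty_iso_of_comp_iso (hf : IsEquiv f) {g h : y ⟶ z} (e : f ≫ g ≅ f ≫ h) :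
    Nonempty (g ≅ h) :=
  have := hf.isEquivalence_precomp z
  ⟨(precomp z f).preimageIso e⟩

/-- A chosen pseudo-inverse of an equivalence. -/
noncomputable def inv (hf : IsEquiv f) : y ⟶ x := hf.choose

/-- The unit of the adjoint equivalence given by the chosen pseudo-inverse. -/
noncomputable def unit (hf : IsEquiv f) : 𝟙 x ≅ f ≫ hf.inv := hf.choose_spec.1.some.symm

/-- The counit of the adjoint equivalence given by the chosen pseudo-inverse. -/
noncomputable def counit (hf : IsEquiv f) : hf.inv ≫ f ≅ 𝟙 y :=
  adjointifyCounit hf.unit hf.choose_spec.2.some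

theorem left_triangle (hf : IsEquiv f) :
    leftZigzag hf.unit.hom hf.counit.hom = (λ_ f).hom ≫ (ρ_ f).inv :=
  congrArg Iso.hom (adjointifyCounit_left_triangle hf.unit hf.choose_spec.2.some)

theorem unit_inv_whiskerRight_leftUnitor (hf : IsEquiv f) :
    hf.unit.inv ▷ f ≫ (λ_ f).hom = (α_ _ _ _).hom ≫ f ◁ hf.counit.hom ≫ (ρ_ f).hom := by
  have h : hf.unit.hom ▷ f ≫ (α_ _ _ _).hom ≫ f ◁ hf.counit.hom = (λ_ f).hom ≫ (ρ_ f).inv := by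
    simpa [leftZigzag, bicategoricalComp] using hf.left_triangle
  rw [← cancel_epi (hf.unit.hom ▷ f), reassoc_of% h]
  simp [← comp_whiskerRight_assoc]

theorem whiskerRight_comp_counit (hf : IsEquiv f) {p : z ⟶ y} {g : z ⟶ x} (φ : p ⟶ g ≫ f) :
    (α_ _ _ _).inv ≫ (φ ▷ hf.inv ≫ (α_ _ _ _).hom ≫ g ◁ hf.unit.inv ≫ (ρ_ _).hom) ▷ f =
      p ◁ hf.counit.hom ≫ (ρ_ _).hom ≫ φ := by
  have h : (α_ g f hf.inv).hom ▷ f ≫ (g ◁ hf.unit.inv) ▷ f ≫ (ρ_ g).hom ▷ f =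
      (α_ (g ≫ f) hf.inv f).hom ≫ (g ≫ f) ◁ hf.counit.hom ≫ (ρ_ (g ≫ f)).hom :=
    calc
      _ = (α_ (g ≫ f) hf.inv f).hom ≫ (α_ g f (hf.inv ≫ f)).hom ≫ g ◁ (α_ f hf.inv f).inv ≫
          g ◁ (hf.unit.inv ▷ f ≫ (λ_ f).hom) := by bicategory
      _ = _ := by
        rw [hf.unit_inv_whiskerRight_leftUnitor]
        simp
  simp only [comp_whiskerRight, h]
  rw [associator_naturality_left_assoc, Iso.inv_hom_id_assoc, ← whisker_exchange_assoc,
    rightUnitor_naturality]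

end IsEquiv

section Pseudofunctors

open scoped Pseudofunctor.StrongTrans

universe w₁ v₁ u₁ w₂ v₂ u₂ w₃ v₃ u₃ w₄ v₄ u₄

variable {B : Type u₁} [Bicategory.{w₁, v₁} B] {C : Type u₂} [Bicategory.{w₂, v₂} C]
  {D : Type u₃} [Bicategory.{w₃, v₃} D] {E : Type u₄} [Bicategory.{w₄, v₄} E]

theorem pseudofunctor_ext {F G : B ⥤ᵖ C} (h : F.toPrelaxFunctor = G.toPrelaxFunctor)
    (hId : F.mapId ≍ G.mapId) (hComp : @F.mapComp ≍ @G.mapComp) : F = G := by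
  cases F
  cases G
  cases h
  cases hId
  cases hComp
  rfl

theorem pseudofunctor_comp_assoc (F : B ⥤ᵖ C) (G : C ⥤ᵖ D) (H : D ⥤ᵖ E) :
    (F.comp G).comp H = F.comp (G.comp H) :=
  pseudofunctor_ext rfl
    (heq_of_eq (funext fun a => Iso.ext
      ((H.map₂_comp (G.map₂ (F.mapId a).hom) (G.mapId (F.obj a)).hom =≫
        (H.mapId (G.obj (F.obj a))).hom).trans (Category.assoc _ _ _))))
    (heq_of_eq (funext₃ fun _ _ _ => funext₂ fun f g => Iso.ext
      ((H.map₂_comp (G.map₂ (F.mapComp f g).hom) (G.mapComp (F.map f) (F.map g)).hom =≫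
        (H.mapComp (G.map (F.map f)) (G.map (F.map g))).hom).trans (Category.assoc _ _ _))))

theorem map₂_associator_inv (F : B ⥤ᵖ C) {a b c d : B} (f : a ⟶ b) (g : b ⟶ c) (h : c ⟶ d) :
    F.map₂ (α_ f g h).inv = (F.mapComp f (g ≫ h)).hom ≫ F.map f ◁ (F.mapComp g h).hom ≫
      (α_ (F.map f) (F.map g) (F.map h)).inv ≫ (F.mapComp f g).inv ▷ F.map h ≫
        (F.mapComp (f ≫ g) h).inv := by
  rw [← cancel_epi (F.map₂ (α_ f g h).hom), ← F.map₂_comp, F.map₂_associator]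
  simp

theorem map₂_leftUnitor_inv (F : B ⥤ᵖ C) {a b : B} (f : a ⟶ b) :
    F.map₂ (λ_ f).inv =
      (λ_ (F.map f)).inv ≫ (F.mapId a).inv ▷ F.map f ≫ (F.mapComp (𝟙 a) f).inv := by
  rw [← cancel_epi (F.map₂ (λ_ f).hom), ← F.map₂_comp, F.map₂_left_unitor]
  simp

theorem map₂_rightUnitor_inv (F : B ⥤ᵖ C) {a b : B} (f : a ⟶ b) :
    F.map₂ (ρ_ f).inv =
      (ρ_ (F.map f)).inv ≫ F.map f ◁ (F.mapId b).inv ≫ (F.mapComp f (𝟙 b)).inv := by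
  rw [← cancel_epi (F.map₂ (ρ_ f).hom), ← F.map₂_comp, F.map₂_right_unitor]
  simp

/-- Postcomposition of a pseudonatural transformation with a pseudofunctor. -/
def postcompTrans {F G : B ⥤ᵖ C} (σ : F ⟶ G) (I : C ⥤ᵖ D) : F.comp I ⟶ G.comp I where
  app x := I.map (σ.app x)
  naturality f := (I.mapComp _ _).symm ≪≫ I.map₂Iso (σ.naturality f) ≪≫ I.mapComp _ _
  naturality_naturality {x y f g} a := by
    have h := congrArg I.map₂ (σ.naturality_naturality a)
    simp only [I.map₂_comp, I.map₂_whisker_left, I.map₂_whisker_right, Category.assoc] at h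
    change I.map₂ (F.map₂ a) ▷ I.map (σ.app y) ≫
        (I.mapComp _ _).inv ≫ I.map₂ (σ.naturality g).hom ≫ (I.mapComp _ _).hom =
      ((I.mapComp _ _).inv ≫ I.map₂ (σ.naturality f).hom ≫ (I.mapComp _ _).hom) ≫
        I.map (σ.app x) ◁ I.map₂ (G.map₂ a)
    simpa [Iso.eq_inv_comp, ← cancel_mono (I.mapComp (σ.app x) (G.map g)).inv] using h
  naturality_id x := by
    have h := congrArg I.map₂ (σ.naturality_id x) =≫
      ((I.mapComp (σ.app x) (𝟙 _)).hom ≫ I.map (σ.app x) ◁ (I.mapId (G.obj x)).hom)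
    simp only [I.map₂_comp, I.map₂_whisker_left, I.map₂_whisker_right, I.map₂_left_unitor,
      map₂_rightUnitor_inv, Category.assoc] at h
    change ((I.mapComp _ _).inv ≫ I.map₂ (σ.naturality (𝟙 x)).hom ≫ (I.mapComp _ _).hom) ≫
        I.map (σ.app x) ◁ (I.map₂ (G.mapId x).hom ≫ (I.mapId (G.obj x)).hom) =
      (I.map₂ (F.mapId x).hom ≫ (I.mapId (F.obj x)).hom) ▷ I.map (σ.app x) ≫
        (λ_ (I.map (σ.app x))).hom ≫ (ρ_ (I.map (σ.app x))).inv
    simpa [Iso.inv_comp_eq] using h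
  naturality_comp {x y z} f g := by
    have h := congrArg I.map₂ (σ.naturality_comp f g) =≫
      ((I.mapComp (σ.app x) _).hom ≫ I.map (σ.app x) ◁ (I.mapComp (G.map f) (G.map g)).hom)
    simp only [I.map₂_comp, I.map₂_whisker_left, I.map₂_whisker_right, I.map₂_associator,
      map₂_associator_inv, Category.assoc] at h
    change ((I.mapComp _ _).inv ≫ I.map₂ (σ.naturality (f ≫ g)).hom ≫ (I.mapComp _ _).hom) ≫
        I.map (σ.app x) ◁ (I.map₂ (G.mapComp f g).hom ≫ (I.mapComp (G.map f) (G.map g)).hom) =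
      (I.map₂ (F.mapComp f g).hom ≫ (I.mapComp (F.map f) (F.map g)).hom) ▷ I.map (σ.app z) ≫
        (α_ _ _ _).hom ≫
        I.map (F.map f) ◁
          ((I.mapComp _ _).inv ≫ I.map₂ (σ.naturality g).hom ≫ (I.mapComp _ _).hom) ≫
        (α_ _ _ _).inv ≫
        ((I.mapComp _ _).inv ≫ I.map₂ (σ.naturality f).hom ≫ (I.mapComp _ _).hom) ▷
          I.map (G.map g) ≫
        (α_ _ _ _).hom
    simpa [Iso.inv_comp_eq] using h

section

variable {F G : B ⥤ᵖ C} {σ : F ⟶ G} {τ : G ⟶ F} (e : σ ≫ τ ≅ 𝟙 F)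

/-- The component at an object of an invertible modification to an identity. -/
def modificationIsoApp (x : B) : σ.app x ≫ τ.app x ≅ 𝟙 (F.obj x) where
  hom := e.hom.as.app x
  inv := e.inv.as.app x
  hom_inv_id := congrArg (fun m => m.as.app x) e.hom_inv_id
  inv_hom_id := congrArg (fun m => m.as.app x) e.inv_hom_id

theorem modificationIsoApp_naturality {x y : B} (f : x ⟶ y) :
    F.map f ◁ (modificationIsoApp e y).hom ≫ (ρ_ (F.map f)).hom ≫ (λ_ (F.map f)).inv =
      ((α_ _ _ _).inv ≫ (σ.naturality f).hom ▷ τ.app y ≫ (α_ _ _ _).hom ≫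
        σ.app x ◁ (τ.naturality f).hom ≫ (α_ _ _ _).inv) ≫
          (modificationIsoApp e x).hom ▷ F.map f :=
  e.hom.as.naturality f

/-- The image under a pseudofunctor of an invertible modification to an identity. -/
def postcompTransIso (I : C ⥤ᵖ D) : postcompTrans σ I ≫ postcompTrans τ I ≅ 𝟙 (F.comp I) :=
  Pseudofunctor.StrongTrans.isoMk
    (fun x => (I.mapComp _ _).symm ≪≫ I.map₂Iso (modificationIsoApp e x) ≪≫ I.mapId _)
    fun {x y} f => by
      have h := (I.map (F.map f) ◁ (I.mapComp (σ.app y) (τ.app y)).inv ≫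
        (I.mapComp (F.map f) (σ.app y ≫ τ.app y)).inv) ≫=
          congrArg I.map₂ (modificationIsoApp_naturality e f) =≫
            ((I.mapComp (𝟙 _) (F.map f)).hom ≫ (I.mapId _).hom ▷ I.map (F.map f))
      simp only [I.map₂_comp, I.map₂_whisker_left, I.map₂_whisker_right, I.map₂_associator,
        I.map₂_right_unitor, map₂_associator_inv, map₂_leftUnitor_inv, Category.assoc] at h
      have naturality :
          I.map (F.map f) ◁ ((I.mapComp _ _).inv ≫ I.map₂ (modificationIsoApp e y).hom ≫
            (I.mapId (F.obj y)).hom) ≫ (ρ_ (I.map (F.map f))).hom ≫ (λ_ (I.map (F.map f))).inv =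
          ((α_ _ _ _).inv ≫
            ((I.mapComp _ _).inv ≫ I.map₂ (σ.naturality f).hom ≫ (I.mapComp _ _).hom) ▷
              I.map (τ.app y) ≫
            (α_ _ _ _).hom ≫
            I.map (σ.app x) ◁
              ((I.mapComp _ _).inv ≫ I.map₂ (τ.naturality f).hom ≫ (I.mapComp _ _).hom) ≫
            (α_ _ _ _).inv) ≫
          ((I.mapComp _ _).inv ≫ I.map₂ (modificationIsoApp e x).hom ≫
            (I.mapId (F.obj x)).hom) ▷ I.map (F.map f) := by
        simpa using h
      exact naturality

/-- If `F` is a retract of `G`, then the functors of `F` on hom-categories factor through those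
of `G`. -/
def mapFunctorFactorization (x y : B) :
    G.mapFunctor x y ⋙ postcomp _ (τ.app y) ⋙ precomp _ (σ.app x) ≅ F.mapFunctor x y :=
  NatIso.ofComponents
    (fun f => whiskerLeftIso (σ.app x) (τ.naturality f) ≪≫ (α_ _ _ _).symm ≪≫
      whiskerRightIso (modificationIsoApp e x) (F.map f) ≪≫ λ_ (F.map f))
    (fun {f g} a => by
      let m := (modificationIsoApp e x).hom
      change σ.app x ◁ G.map₂ a ▷ τ.app y ≫ σ.app x ◁ (τ.naturality g).hom ≫
          (α_ _ _ _).inv ≫ m ▷ F.map g ≫ (λ_ (F.map g)).hom =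
        (σ.app x ◁ (τ.naturality f).hom ≫
          (α_ _ _ _).inv ≫ m ▷ F.map f ≫ (λ_ (F.map f)).hom) ≫ F.map₂ a
      rw [← whiskerLeft_comp_assoc, τ.naturality_naturality, whiskerLeft_comp, Category.assoc,
        associator_inv_naturality_right_assoc, whisker_exchange_assoc, leftUnitor_naturality]
      simp only [Category.assoc])

end

/-- The object `X` of a bicategory is a retract of `Y` up to an invertible 2-arrow. -/
def IsPseudoretract (X Y : B) : Prop :=
  ∃ (i : X ⟶ Y) (r : Y ⟶ X), Nonempty (i ≫ r ≅ 𝟙 X)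

namespace IsPseudoretract

theorem of_equivalence {X Y : B} (e : X ≌ Y) : IsPseudoretract Y X :=
  ⟨e.inv, e.hom, ⟨e.counit⟩⟩

theorem map {X Y : B} (h : IsPseudoretract X Y) (F : B ⥤ᵖ C) :
    IsPseudoretract (F.obj X) (F.obj Y) := by
  obtain ⟨i, r, ⟨e⟩⟩ := h
  exact ⟨F.map i, F.map r, ⟨(F.mapComp i r).symm ≪≫ F.map₂Iso e ≪≫ F.mapId X⟩⟩

theorem of_map (F : B ⥤ᵖ C) [∀ X Y, (F.mapFunctor X Y).IsEquivalence] {X Y : B}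
    (h : IsPseudoretract (F.obj X) (F.obj Y)) : IsPseudoretract X Y := by
  obtain ⟨i, r, ⟨e⟩⟩ := h
  let i' : F.map ((F.mapFunctor X Y).objPreimage i) ≅ i := (F.mapFunctor X Y).objObjPreimageIso i
  let r' : F.map ((F.mapFunctor Y X).objPreimage r) ≅ r := (F.mapFunctor Y X).objObjPreimageIso r
  exact ⟨_, _, ⟨(F.mapFunctor X X).preimageIso
    (F.mapComp _ _ ≪≫ whiskerRightIso i' _ ≪≫ whiskerLeftIso _ r' ≪≫ e ≪≫ (F.mapId X).symm)⟩⟩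

theorem postcomp {F G : B ⥤ᵖ C} (h : IsPseudoretract F G) (I : C ⥤ᵖ D) :
    IsPseudoretract (F.comp I) (G.comp I) := by
  obtain ⟨σ, τ, ⟨e⟩⟩ := h
  exact ⟨postcompTrans σ I, postcompTrans τ I, ⟨postcompTransIso e I⟩⟩

theorem locallyEssentiallySmall {F : B ⥤ᵖ D} [∀ x y, (F.mapFunctor x y).IsEquivalence]
    {G : B ⥤ᵖ C} {I : C ⥤ᵖ D} (h : IsPseudoretract F (G.comp I))
    (hC : LocallyEssentiallySmall.{s} C) : LocallyEssentiallySmall.{s} B := by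
  obtain ⟨σ, τ, ⟨e⟩⟩ := h
  intro x y
  have := hC (G.obj x) (G.obj y)
  let R := Bicategory.postcomp _ (τ.app y) ⋙ Bicategory.precomp _ (σ.app x)
  exact essentiallySmall_of_retract (G.mapFunctor x y)
    (I.mapFunctor _ _ ⋙ R ⋙ (F.mapFunctor x y).inv)
    (Functor.isoWhiskerRight (mapFunctorFactorization e x y) (F.mapFunctor x y).inv ≪≫
      (F.mapFunctor x y).asEquivalence.unitIso.symm)

end IsPseudoretract

theorem isPseudoretract_inducedBicategory_iff {ι : Type u₁} {F : ι → C}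
    {X Y : InducedBicategory C F} : IsPseudoretract X Y ↔ IsPseudoretract (F X) (F Y) :=
  ⟨fun h => h.map InducedBicategory.forget.toPseudofunctor, fun ⟨i, r, ⟨e⟩⟩ =>
    ⟨InducedBicategory.mkHom i, InducedBicategory.mkHom r, ⟨InducedBicategory.isoMk e⟩⟩⟩

end Pseudofunctors

section ULiftBicat

universe w₁ v₁ u₁ w₂ v₂ u₂

/-- A copy of the bicategory `L` in universes that are large enough for both `L` and `M`: only the
universe levels of `M` matter. -/
structure ULiftBicat (L : Type u₁) [Bicategory.{w₁, v₁} L] (M : Type u₂) [Bicategory.{w₂, v₂} M] :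
    Type (max u₁ u₂) where
  /-- The underlying object. -/
  down : L

namespace ULiftBicat

variable {L : Type u₁} [Bicategory.{w₁, v₁} L] {M : Type u₂} [Bicategory.{w₂, v₂} M]

/-- The 1-arrows of `ULiftBicat L M`. -/
structure Hom (X Y : ULiftBicat L M) : Type (max v₁ v₂) where
  /-- The underlying 1-arrow. -/
  down : X.down ⟶ Y.down

/-- The 2-arrows of `ULiftBicat L M`. -/
@[ext]
structure Hom₂ {X Y : ULiftBicat L M} (f g : Hom X Y) : Type (max w₁ w₂) where
  /-- The underlying 2-arrow. -/
  down : f.down ⟶ g.down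

instance : CategoryStruct (ULiftBicat L M) where
  Hom := Hom
  id X := ⟨𝟙 X.down⟩
  comp f g := ⟨f.down ≫ g.down⟩

instance (X Y : ULiftBicat L M) : Category (X ⟶ Y) where
  Hom := Hom₂
  id f := ⟨𝟙 f.down⟩
  comp α β := ⟨α.down ≫ β.down⟩
  id_comp _ := Hom₂.ext (Category.id_comp _)
  comp_id _ := Hom₂.ext (Category.comp_id _)
  assoc _ _ _ := Hom₂.ext (Category.assoc _ _ _)

/-- The invertible 2-arrow of `ULiftBicat L M` given by one of `L`. -/
def isoMk {X Y : ULiftBicat L M} {f g : X ⟶ Y} (e : Hom.down f ≅ Hom.down g) : f ≅ g where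
  hom := ⟨e.hom⟩
  inv := ⟨e.inv⟩
  hom_inv_id := Hom₂.ext e.hom_inv_id
  inv_hom_id := Hom₂.ext e.inv_hom_id

instance : Bicategory (ULiftBicat L M) where
  homCategory _ _ := inferInstance
  whiskerLeft f _ _ (α : Hom₂ _ _) := Hom₂.mk (Hom.down f ◁ α.down)
  whiskerRight (α : Hom₂ _ _) f := Hom₂.mk (α.down ▷ Hom.down f)
  associator f g h := isoMk (α_ (Hom.down f) (Hom.down g) (Hom.down h))
  leftUnitor f := isoMk (λ_ (Hom.down f))
  rightUnitor f := isoMk (ρ_ (Hom.down f))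
  whiskerLeft_id _ _ := Hom₂.ext (whiskerLeft_id _ _)
  whiskerLeft_comp _ _ _ _ _ _ := Hom₂.ext (whiskerLeft_comp _ _ _)
  id_whiskerLeft _ := Hom₂.ext (id_whiskerLeft _)
  comp_whiskerLeft _ _ _ _ _ := Hom₂.ext (comp_whiskerLeft _ _ _)
  id_whiskerRight _ _ := Hom₂.ext (id_whiskerRight _ _)
  comp_whiskerRight _ _ _ := Hom₂.ext (comp_whiskerRight _ _ _)
  whiskerRight_id _ := Hom₂.ext (whiskerRight_id _)
  whiskerRight_comp _ _ _ := Hom₂.ext (whiskerRight_comp _ _ _)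
  whisker_assoc _ _ _ _ _ := Hom₂.ext (whisker_assoc _ _ _)
  whisker_exchange _ _ := Hom₂.ext (whisker_exchange _ _)
  pentagon _ _ _ _ := Hom₂.ext (pentagon _ _ _ _)
  triangle _ _ := Hom₂.ext (triangle _ _)

variable (L M) in
/-- The canonical pseudofunctor from `L` to `ULiftBicat L M`. -/
def up : L ⥤ᵖ ULiftBicat L M :=
  (StrictPseudofunctor.mk'
    { obj x := ⟨x⟩
      map f := Hom.mk f
      map₂ α := Hom₂.mk α
      map₂_id _ := rfl
      map₂_comp _ _ := rfl
      map_id _ := rfl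
      map_comp _ _ := rfl
      map₂_whisker_left f _ _ α :=
        Hom₂.ext ((Category.id_comp _).trans (Category.comp_id (f ◁ α))).symm
      map₂_whisker_right α f :=
        Hom₂.ext ((Category.id_comp _).trans (Category.comp_id (α ▷ f))).symm
      map₂_left_unitor f := Hom₂.ext (Category.id_comp (λ_ f).hom).symm
      map₂_right_unitor f := Hom₂.ext (Category.id_comp (ρ_ f).hom).symm
      map₂_associator f g h :=
        Hom₂.ext ((Category.id_comp _).trans (Category.comp_id (α_ f g h).hom)).symm
      }).toPseudofunctor

instance (x y : L) : ((up L M).mapFunctor x y).IsEquivalence where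
  faithful := ⟨fun h => congrArg Hom₂.down h⟩
  full := ⟨fun α => ⟨Hom₂.down α, rfl⟩⟩
  essSurj := ⟨fun f => ⟨Hom.down f, ⟨Iso.refl _⟩⟩⟩

end ULiftBicat

end ULiftBicat

namespace Fraction

variable {K : Type u} [Bicategory.{w, v} K] [Bicategory.Strict K] {S : StrictTwoSite K} {x y : K}

section

attribute [local simp] Strict.associator_eqToIso

variable {A B : Fraction S x y} (t : Hom A B) {z : K}

theorem canon_whiskerRight_comp_app {a a' : z ⟶ A.obj} {b : z ⟶ B.obj}
    (h : a ≫ A.left = a' ≫ A.left) (h' : a' ≫ A.left = b ≫ B.left) :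
    canon (S.ff _ A.mem) h ▷ A.right ≫ t.app a' b h' = t.app a b (h.trans h') := by
  rw [← id_app, ← comp_app]
  exact congrArg (fun t' : Hom A B => t'.app a b _) (Category.id_comp (X := A) (Y := B) t)

theorem app_comp_canon_whiskerRight {a : z ⟶ A.obj} {b b' : z ⟶ B.obj}
    (h : a ≫ A.left = b ≫ B.left) (h' : b ≫ B.left = b' ≫ B.left) :
    t.app a b h ≫ canon (S.ff _ B.mem) h' ▷ B.right = t.app a b' (h.trans h') := by
  rw [← id_app, ← comp_app]
  exact congrArg (fun t' : Hom A B => t'.app a b' _) (Category.comp_id (X := A) (Y := B) t)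

instance isIso_app [IsIso t.cell] (a : z ⟶ A.obj) (b : z ⟶ B.obj)
    (h : a ≫ A.left = b ≫ B.left) : IsIso (t.app a b h) := by
  unfold Hom.app
  infer_instance

/-- The inverse of a map of fractions with invertible underlying 2-arrow. -/
noncomputable def Hom.inverse [IsIso t.cell] : Hom B A where
  cell := inv (t.app (p₂ B A) (p₁ B A) (w B A).symm)

theorem inverse_app [IsIso t.cell] (a : z ⟶ A.obj) (b : z ⟶ B.obj)
    (h : a ≫ A.left = b ≫ B.left) : t.inverse.app b a h.symm = inv (t.app a b h) := by
  obtain ⟨l, rfl, rfl⟩ : ∃ l : z ⟶ P B A, l ≫ p₁ B A = b ∧ l ≫ p₂ B A = a :=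
    ⟨_, pair_p₁ b a h.symm, pair_p₂ b a h.symm⟩
  apply IsIso.eq_inv_of_hom_inv_id
  rw [Hom.app_precomp _ l _ _ (w B A), Hom.app_self, t.app_precomp l _ _ (w B A).symm]
  simp [Hom.inverse, ← whiskerLeft_comp_assoc]

/-- The isomorphism of fractions given by a map with invertible underlying 2-arrow. -/
noncomputable def isoOfIsIsoCell [IsIso t.cell] : A ≅ B where
  hom := t
  inv := t.inverse
  hom_inv_id := by
    apply Hom.ext_of_cover (p₁₃ A B A) (S.snd_mem _ _ _)
    refine (comp_app t t.inverse _ _ _ (w₁ A B A) (w₃ A B A)).trans ?_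
    refine Eq.trans ?_ (id_app (A := A) _ _ ((w₁ A B A).trans (w₃ A B A))).symm
    rw [inverse_app t _ _ (w₃ A B A).symm, IsIso.comp_inv_eq, canon_whiskerRight_comp_app]
  inv_hom_id := by
    apply Hom.ext_of_cover (p₁₃ B A B) (S.snd_mem _ _ _)
    refine (comp_app t.inverse t _ _ _ (w₁ B A B) (w₃ B A B)).trans ?_
    refine Eq.trans ?_ (id_app (A := B) _ _ ((w₁ B A B).trans (w₃ B A B))).symm
    rw [inverse_app t _ _ (w₁ B A B).symm, IsIso.inv_comp_eq, app_comp_canon_whiskerRight]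

theorem isIso_canon {u x : K} {j : u ⟶ x} (hj : IsFF j) {a b : z ⟶ u} (h : a ≫ j = b ≫ j) :
    IsIso (canon hj h) := by
  have := fun {a b : z ⟶ u} (h : a ≫ j = b ≫ j) => canon_whisker hj h
  exact ⟨canon hj h.symm, (hj _ _).1 (by simp [this]), (hj _ _).1 (by simp [this])⟩

/-- The isomorphism of fractions induced by a morphism of spans commuting strictly with the left
legs and up to an isomorphism with the right legs. -/
noncomputable def isoOfSpanMap (l : A.obj ⟶ B.obj) (hl : l ≫ B.left = A.left)
    (e : A.right ≅ l ≫ B.right) : A ≅ B :=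
  have h : (p₁ A B ≫ l) ≫ B.left = p₂ A B ≫ B.left := by rw [Strict.assoc, hl, w]
  let t : Hom A B := ⟨p₁ A B ◁ e.hom ≫ (α_ _ _ _).inv ≫ canon (S.ff _ B.mem) h ▷ B.right⟩
  have : IsIso t.cell := by
    have := isIso_canon (S.ff _ B.mem) h
    infer_instance
  isoOfIsIsoCell t

end

theorem essentiallySmall (hK : LocallyEssentiallySmall.{s} K) (hW : WISC.{s} S) (x y : K) :
    EssentiallySmall.{s} (Fraction S x y) := by
  have := fun z : K => hK z y
  obtain ⟨I, c, p, hp, exists_lift⟩ := hW x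
  have : LocallySmall.{s} (Fraction S x y) :=
    ⟨fun A B => small_of_injective (f := fun t : Hom A B => t.cell) fun _ _ h => Hom.ext h⟩
  refine essentiallySmall_of_representatives (T := Σ i, Skeleton (c i ⟶ y))
    (fun d => ⟨c d.1, p d.1, hp d.1, (fromSkeleton _).obj d.2⟩) fun A => ?_
  obtain ⟨i, a, ha⟩ := exists_lift A.obj A.left A.mem
  exact ⟨⟨i, toSkeleton (a ≫ A.right)⟩,
    ⟨isoOfSpanMap a ha (fromSkeletonToSkeletonIso (a ≫ A.right))⟩⟩

end Fraction

section Presentation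

universe w₁ v₁ u₁

variable {K : Type u} [Bicategory.{w, v} K] {L : Type u₁} [Bicategory.{w₁, v₁} L] {Q : K ⥤ᵖ L}

/-- A presentation of a 1-arrow `h` between values of `Q` by arrows of `K`: an isomorphism from
`Q a ≫ h` to `Q f`. If `a` is a cover that is inverted by `Q`, this exhibits `h` as the fraction
with legs `a` and `f`. -/
abbrev Presentation (Q : K ⥤ᵖ L) {x y z : K} (a : z ⟶ x) (h : Q.obj x ⟶ Q.obj y) (f : z ⟶ y) :
    Type _ :=
  Q.map a ≫ h ≅ Q.map f

/-- The restriction of a presentation along an arrow `q`. -/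
def Presentation.restrict {t x y z : K} {a : z ⟶ x} {h : Q.obj x ⟶ Q.obj y} {f : z ⟶ y}
    (q : t ⟶ z) (χ : Presentation Q a h f) : Presentation Q (q ≫ a) h (q ≫ f) :=
  whiskerRightIso (Q.mapComp q a) h ≪≫ α_ _ _ _ ≪≫ whiskerLeftIso (Q.map q) χ ≪≫
    (Q.mapComp q f).symm

@[simp]
theorem Presentation.restrict_hom {t x y z : K} {a : z ⟶ x} {h : Q.obj x ⟶ Q.obj y} {f : z ⟶ y}
    (q : t ⟶ z) (χ : Presentation Q a h f) :
    (χ.restrict q).hom = (Q.mapComp q a).hom ▷ h ≫ (α_ _ _ _).hom ≫ Q.map q ◁ χ.hom ≫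
      (Q.mapComp q f).inv :=
  rfl

theorem small_hom_of_presentations (hK : LocallyEssentiallySmall.{s} K) {u x y : K} {j : u ⟶ x}
    [(Q.mapFunctor u y).Full] (hj : IsEquiv (Q.map j)) {f g : Q.obj x ⟶ Q.obj y} {d d' : u ⟶ y}
    (χ : Presentation Q j f d) (χ' : Presentation Q j g d') : Small.{s} (f ⟶ g) := by
  have := hK u y
  have : Small.{s} (Q.map d ⟶ Q.map d') :=
    small_of_surjective (Q.mapFunctor u y).map_surjective
  exact small_of_injective ((χ.homCongr χ').injective.comp (hj.whiskerLeft_injective f g))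

theorem essentiallySmall_hom_of_presentations [Bicategory.Strict K] {S : StrictTwoSite K}
    (hK : LocallyEssentiallySmall.{s} K) (hW : WISC.{s} S) (hQ : Inverts S.J Q) (x y : K)
    [∀ z, (Q.mapFunctor z y).Full]
    (exists_presentation : ∀ f : Q.obj x ⟶ Q.obj y, ∃ (u : K) (j : u ⟶ x) (d : u ⟶ y),
      S.J j ∧ Nonempty (Presentation Q j f d)) :
    EssentiallySmall.{s} (Q.obj x ⟶ Q.obj y) := by
  have := fun z => hK z y
  have : LocallySmall.{s} (Q.obj x ⟶ Q.obj y) := ⟨fun f g => by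
    obtain ⟨u, j, d, hj, ⟨χ⟩⟩ := exists_presentation f
    obtain ⟨v, k, d', hk, ⟨χ'⟩⟩ := exists_presentation g
    have hq := hQ _ (S.comp_mem _ _ (S.snd_mem j hj k) hk)
    have χ₁ := χ.restrict (S.fst j hj k)
    rw [(S.isPullback j hj k).w] at χ₁
    exact small_hom_of_presentations hK hq χ₁ (χ'.restrict (S.snd j hj k))⟩
  obtain ⟨I, c, p, hp, weaklyInitial⟩ := hW x
  refine essentiallySmall_of_representatives (T := Σ i, Skeleton (c i ⟶ y))
    (fun t => (hQ _ (hp t.1)).inv ≫ Q.map ((fromSkeleton _).obj t.2)) fun f => ?_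
  obtain ⟨u, j, d, hj, ⟨χ⟩⟩ := exists_presentation f
  obtain ⟨i, a, ha⟩ := weaklyInitial u j hj
  have χ' := χ.restrict a
  rw [ha] at χ'
  exact ⟨⟨i, toSkeleton (a ≫ d)⟩, (hQ _ (hp i)).nonempty_iso_of_comp_iso
    ((α_ _ _ _).symm ≪≫ whiskerRightIso (hQ _ (hp i)).unit.symm _ ≪≫ λ_ _ ≪≫
      Q.map₂Iso (fromSkeletonToSkeletonIso _) ≪≫ χ'.symm)⟩

variable {t z x y y' : K}

namespace Presentation

/-- The presentation of an identity given by an isomorphism in `K`. -/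
def id {a f : z ⟶ x} (θ : a ≅ f) : Presentation Q a (𝟙 _) f :=
  ρ_ _ ≪≫ Q.map₂Iso θ

@[simp]
theorem id_hom {a f : z ⟶ x} (θ : a ≅ f) :
    (id θ : Presentation Q a _ f).hom = (ρ_ _).hom ≫ Q.map₂ θ.hom :=
  rfl

/-- The presentation of `Q g` given by an isomorphism in `K`. -/
def of {a : z ⟶ x} {g : x ⟶ y} {f : z ⟶ y} (θ : a ≫ g ≅ f) : Presentation Q a (Q.map g) f :=
  (Q.mapComp a g).symm ≪≫ Q.map₂Iso θ

@[simp]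
theorem of_hom {a : z ⟶ x} {g : x ⟶ y} {f : z ⟶ y} (θ : a ≫ g ≅ f) :
    (of θ : Presentation Q a _ f).hom = (Q.mapComp a g).inv ≫ Q.map₂ θ.hom :=
  rfl

/-- The presentation of the pseudo-inverse of `Q q` given by an isomorphism in `K`. -/
noncomputable def inv {q : x ⟶ y} (hq : IsEquiv (Q.map q)) {a : z ⟶ y} {f : z ⟶ x}
    (θ : f ≫ q ≅ a) : Presentation Q a hq.inv f :=
  whiskerRightIso (Q.map₂Iso θ.symm ≪≫ Q.mapComp f q) hq.inv ≪≫ α_ _ _ _ ≪≫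
    whiskerLeftIso (Q.map f) hq.unit.symm ≪≫ ρ_ _

@[simp]
theorem inv_hom {q : x ⟶ y} (hq : IsEquiv (Q.map q)) {a : z ⟶ y} {f : z ⟶ x} (θ : f ≫ q ≅ a) :
    (inv hq θ).hom = (Q.map₂ θ.inv ≫ (Q.mapComp f q).hom) ▷ hq.inv ≫ (α_ _ _ _).hom ≫
      Q.map f ◁ hq.unit.inv ≫ (ρ_ _).hom :=
  rfl

/-- The composite of two presentations. -/
def comp {a : z ⟶ x} {h : Q.obj x ⟶ Q.obj y} {f : z ⟶ y} {k : Q.obj y ⟶ Q.obj y'} {g : z ⟶ y'}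
    (χ : Presentation Q a h f) (ψ : Presentation Q f k g) : Presentation Q a (h ≫ k) g :=
  (α_ _ _ _).symm ≪≫ whiskerRightIso χ k ≪≫ ψ

@[simp]
theorem comp_hom {a : z ⟶ x} {h : Q.obj x ⟶ Q.obj y} {f : z ⟶ y} {k : Q.obj y ⟶ Q.obj y'}
    {g : z ⟶ y'} (χ : Presentation Q a h f) (ψ : Presentation Q f k g) :
    (χ.comp ψ).hom = (α_ _ _ _).inv ≫ χ.hom ▷ k ≫ ψ.hom :=
  rfl

theorem restrict_id (q : t ⟶ z) {a f : z ⟶ x} (θ : a ≅ f) :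
    (id θ : Presentation Q a _ f).restrict q = id (whiskerLeftIso q θ) := by
  ext
  simp

theorem restrict_of (q : t ⟶ z) {a : z ⟶ x} {g : x ⟶ y} {f : z ⟶ y} (θ : a ≫ g ≅ f) :
    (of θ : Presentation Q a _ f).restrict q = of (α_ _ _ _ ≪≫ whiskerLeftIso q θ) := by
  ext
  simp

theorem restrict_inv (p : t ⟶ z) {q : x ⟶ y} (hq : IsEquiv (Q.map q)) {a : z ⟶ y} {f : z ⟶ x}
    (θ : f ≫ q ≅ a) : (inv hq θ).restrict p = inv hq (α_ _ _ _ ≪≫ whiskerLeftIso p θ) := by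
  have h : (Q.mapComp p (f ≫ q)).inv ≫ Q.map₂ (α_ p f q).inv ≫ (Q.mapComp (p ≫ f) q).hom =
      Q.map p ◁ (Q.mapComp f q).hom ≫ (α_ _ _ _).inv ≫ (Q.mapComp p f).inv ▷ Q.map q := by
    rw [Iso.inv_comp_eq, Q.mapComp_assoc_right_hom_assoc]
    simp
  ext
  simp only [restrict_hom, inv_hom, Iso.trans_inv, whiskerLeftIso_inv, Q.map₂_comp, Category.assoc,
    Q.map₂_whisker_left, h]
  simp only [comp_whiskerRight, whiskerLeft_comp, Category.assoc, associator_naturality_left_assoc,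
    ← whisker_exchange_assoc, rightUnitor_naturality]
  simp

theorem restrict_comp (q : t ⟶ z) {a : z ⟶ x} {h : Q.obj x ⟶ Q.obj y} {f : z ⟶ y}
    {k : Q.obj y ⟶ Q.obj y'} {g : z ⟶ y'} (χ : Presentation Q a h f) (ψ : Presentation Q f k g) :
    (χ.comp ψ).restrict q = (χ.restrict q).comp (ψ.restrict q) := by
  ext
  simp

end Presentation

/-- The 2-arrow `α` corresponds, under presentations `χ` of its domain and `χ'` of its codomain, to
the 2-arrow `b'` of `K` lying over `b`. -/
def Intertwines {a a' : z ⟶ x} {h h' : Q.obj x ⟶ Q.obj y} {f f' : z ⟶ y}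
    (χ : Presentation Q a h f) (χ' : Presentation Q a' h' f') (b : a ⟶ a') (α : h ⟶ h')
    (b' : f ⟶ f') : Prop :=
  χ.hom ≫ Q.map₂ b' = Q.map₂ b ▷ h ≫ Q.map a' ◁ α ≫ χ'.hom

namespace Intertwines

variable {a a' a'' : z ⟶ x} {h h' h'' : Q.obj x ⟶ Q.obj y} {f f' f'' : z ⟶ y}
  {χ : Presentation Q a h f} {χ' : Presentation Q a' h' f'} {χ'' : Presentation Q a'' h'' f''}
  {b : a ⟶ a'} {α : h ⟶ h'} {c : f ⟶ f'}

theorem trans {b' : a' ⟶ a''} {α' : h' ⟶ h''} {c' : f' ⟶ f''} (i : Intertwines χ χ' b α c)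
    (i' : Intertwines χ' χ'' b' α' c') : Intertwines χ χ'' (b ≫ b') (α ≫ α') (c ≫ c') := by
  unfold Intertwines at *
  simp [reassoc_of% i, i', whisker_exchange_assoc]

theorem comp {k k' : Q.obj y ⟶ Q.obj y'} {g g' : z ⟶ y'} {ψ : Presentation Q f k g}
    {ψ' : Presentation Q f' k' g'} {β : k ⟶ k'} {d : g ⟶ g'} (i : Intertwines χ χ' b α c)
    (j : Intertwines ψ ψ' c β d) :
    Intertwines (χ.comp ψ) (χ'.comp ψ') b (α ▷ k ≫ h' ◁ β) d := by
  unfold Intertwines at *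
  have e := whisker_exchange χ'.hom β
  simp only [Presentation.comp_hom, Category.assoc, j, ← comp_whiskerRight_assoc, i]
  simp [← reassoc_of% e]

theorem restrict_iff_whiskerLeft (q : t ⟶ z) :
    Intertwines (χ.restrict q) (χ'.restrict q) (q ◁ b) α (q ◁ c) ↔
      Q.map q ◁ (χ.hom ≫ Q.map₂ c) = Q.map q ◁ (Q.map₂ b ▷ h ≫ Q.map a' ◁ α ≫ χ'.hom) := by
  have l : (χ.restrict q).hom ≫ Q.map₂ (q ◁ c) = (Q.mapComp q a).hom ▷ h ≫ (α_ _ _ _).hom ≫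
      Q.map q ◁ (χ.hom ≫ Q.map₂ c) ≫ (Q.mapComp q f').inv := by simp
  have r : Q.map₂ (q ◁ b) ▷ h ≫ Q.map (q ≫ a') ◁ α ≫ (χ'.restrict q).hom =
      (Q.mapComp q a).hom ▷ h ≫ (α_ _ _ _).hom ≫
        Q.map q ◁ (Q.map₂ b ▷ h ≫ Q.map a' ◁ α ≫ χ'.hom) ≫ (Q.mapComp q f').inv := by
    simp [whisker_exchange_assoc]
  rw [Intertwines, l, r]
  simp only [cancel_epi, cancel_mono]

theorem restrict (i : Intertwines χ χ' b α c) (q : t ⟶ z) :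
    Intertwines (χ.restrict q) (χ'.restrict q) (q ◁ b) α (q ◁ c) :=
  (restrict_iff_whiskerLeft q).2 (congrArg _ i)

theorem of_restrict {q : t ⟶ z} (hq : IsEquiv (Q.map q))
    (i : Intertwines (χ.restrict q) (χ'.restrict q) (q ◁ b) α (q ◁ c)) :
    Intertwines χ χ' b α c :=
  hq.whiskerLeft_injective _ _ ((restrict_iff_whiskerLeft q).1 i)

theorem unique (ha : IsEquiv (Q.map a)) {χ' : Presentation Q a h' f'} {α' : h ⟶ h'}
    (i : Intertwines χ χ' (𝟙 a) α c) (i' : Intertwines χ χ' (𝟙 a) α' c) : α = α' := by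
  refine ha.whiskerLeft_injective _ _ ?_
  simpa [cancel_mono] using i.symm.trans i'

theorem id {a a' f f' : z ⟶ x} (θ : a ≅ f) (θ' : a' ≅ f') (b : a ⟶ a') :
    Intertwines (Presentation.id θ : Presentation Q a _ f) (.id θ') b (𝟙 _)
      (θ.inv ≫ b ≫ θ'.hom) := by
  simp [Intertwines, Q.map₂_hom_inv_assoc]

theorem of {a a' : z ⟶ x} {g g' : x ⟶ y} {f f' : z ⟶ y} (θ : a ≫ g ≅ f) (θ' : a' ≫ g' ≅ f')
    (b : a ⟶ a') (c : g ⟶ g') :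
    Intertwines (Presentation.of θ : Presentation Q a _ f) (.of θ') b (Q.map₂ c)
      (θ.inv ≫ b ▷ g ≫ a' ◁ c ≫ θ'.hom) := by
  simp [Intertwines, Q.map₂_hom_inv_assoc]

theorem inv {q : x ⟶ y} (hq : IsEquiv (Q.map q)) {a a' : z ⟶ y} {f f' : z ⟶ x} (θ : f ≫ q ≅ a)
    (θ' : f' ≫ q ≅ a') {b : a ⟶ a'} {c : f ⟶ f'} (h : c ▷ q = θ.hom ≫ b ≫ θ'.inv) :
    Intertwines (Presentation.inv hq θ) (.inv hq θ') b (𝟙 _) c := by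
  have e : (Q.map₂ θ.inv ≫ (Q.mapComp f q).hom) ≫ Q.map₂ c ▷ Q.map q =
      Q.map₂ b ≫ Q.map₂ θ'.inv ≫ (Q.mapComp f' q).hom := by
    have hc : Q.map₂ c ▷ Q.map q = (Q.mapComp f q).inv ≫ Q.map₂ (c ▷ q) ≫ (Q.mapComp f' q).hom := by
      simp
    simp [hc, h, Q.map₂_inv_hom_assoc]
  simp only [Intertwines, Presentation.inv_hom, whiskerLeft_id, Category.id_comp, Category.assoc]
  rw [← rightUnitor_naturality, whisker_exchange_assoc, ← associator_naturality_left_assoc,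
    ← comp_whiskerRight_assoc, e, comp_whiskerRight_assoc]

end Intertwines

end Presentation

theorem StrictTwoSite.weakEquivalences_of_mem {K : Type u} [Bicategory.{w, v} K]
    [Bicategory.Strict K] (S : StrictTwoSite K) {u x : K} {j : u ⟶ x} (hj : S.J j) :
    weakEquivalences S j :=
  ⟨S.ff j hj, u, j, 𝟙 u, hj, ⟨λ_ j⟩⟩

/-- Formal composites of arrows of `B` and formal inverses of arrows in `W`. -/
inductive Zigzag {B : Type u} [Bicategory.{w, v} B] (W : ArrowClass B) : B → B → Type (max u v)
  | id (x : B) : Zigzag W x x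
  | of {x y : B} (f : x ⟶ y) : Zigzag W x y
  | inv {x y : B} (q : x ⟶ y) (hq : W q) : Zigzag W y x
  | comp {x y z : B} (e : Zigzag W x y) (e' : Zigzag W y z) : Zigzag W x z

namespace Zigzag

section Presentations

variable {B : Type u} [Bicategory.{w, v} B] {W : ArrowClass B} {L : Type u'}
  [Bicategory.{w', v'} L] {Q : B ⥤ᵖ L} (hQ : Inverts W Q)

/-- The composite in `L` of a zigzag in `B`, for a pseudofunctor `B ⥤ᵖ L` inverting `W`. -/
noncomputable def real : ∀ {x y : B}, Zigzag W x y → (Q.obj x ⟶ Q.obj y)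
  | _, _, id x => 𝟙 (Q.obj x)
  | _, _, of f => Q.map f
  | _, _, inv q hq => (hQ q hq).inv
  | _, _, comp e e' => real e ≫ real e'

/-- A presentation of the composite of a zigzag is standard if it is put together from the
presentations of the single steps of the zigzag given by invertible 2-arrows of `B`. -/
def IsStandard : ∀ {x y : B} (e : Zigzag W x y) {z : B} {a : z ⟶ x} {f : z ⟶ y},
    Presentation Q a (e.real hQ) f → Prop
  | _, _, id _, _, _, _, χ => ∃ θ, χ = .id θ
  | _, _, of _, _, _, _, χ => ∃ θ, χ = .of θ
  | _, _, inv q hq, _, _, _, χ => ∃ θ, χ = .inv (hQ q hq) θ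
  | _, _, comp e e', _, a, f, χ => ∃ (f' : _) (χ₁ : Presentation Q a (e.real hQ) f')
      (χ₂ : Presentation Q f' (e'.real hQ) f), e.IsStandard χ₁ ∧ e'.IsStandard χ₂ ∧ χ = χ₁.comp χ₂

variable {hQ}

theorem IsStandard.restrict {t x y z : B} (q : t ⟶ z) {e : Zigzag W x y} {a : z ⟶ x} {f : z ⟶ y}
    {χ : Presentation Q a (e.real hQ) f} (h : e.IsStandard hQ χ) :
    e.IsStandard hQ (χ.restrict q) := by
  induction e with
  | id x =>
    obtain ⟨θ, rfl⟩ := h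
    exact ⟨_, Presentation.restrict_id q θ⟩
  | of g =>
    obtain ⟨θ, rfl⟩ := h
    exact ⟨_, Presentation.restrict_of q θ⟩
  | inv j hj =>
    obtain ⟨θ, rfl⟩ := h
    exact ⟨_, Presentation.restrict_inv q _ θ⟩
  | comp e e' ih ih' =>
    obtain ⟨f', χ₁, χ₂, h₁, h₂, rfl⟩ := h
    exact ⟨_, _, _, ih h₁, ih' h₂, Presentation.restrict_comp q χ₁ χ₂⟩

variable (hQ)

/-- A 2-arrow of `L` between the composites of two zigzags is induced from `B` if it corresponds
to 2-arrows of `B` under all standard presentations of the two zigzags. -/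
def IsInduced {x y : B} (e e' : Zigzag W x y) (α : e.real hQ ⟶ e'.real hQ) : Prop :=
  ∀ ⦃z : B⦄ ⦃a a' : z ⟶ x⦄ ⦃f f' : z ⟶ y⦄ ⦃χ : Presentation Q a (e.real hQ) f⦄
    ⦃χ' : Presentation Q a' (e'.real hQ) f'⦄, e.IsStandard hQ χ → e'.IsStandard hQ χ' →
    ∀ b : a ⟶ a', ∃ b' : f ⟶ f', Intertwines χ χ' b α b'

theorem isInduced_map₂ {x y : B} {f g : x ⟶ y} (c : f ⟶ g) :
    IsInduced hQ (of f) (of g) (Q.map₂ c) := by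
  rintro z a a' f f' χ χ' ⟨θ, rfl⟩ ⟨θ', rfl⟩ b
  exact ⟨_, .of θ θ' b c⟩

variable {hQ}

theorem IsInduced.hcomp {x y z : B} {e e' : Zigzag W x y} {k k' : Zigzag W y z}
    {α : e.real hQ ⟶ e'.real hQ} {β : k.real hQ ⟶ k'.real hQ} (hα : IsInduced hQ e e' α)
    (hβ : IsInduced hQ k k' β) :
    IsInduced hQ (e.comp k) (e'.comp k') (α ▷ k.real hQ ≫ e'.real hQ ◁ β) := by
  rintro t a a' f f' χ χ' ⟨g, χ₁, χ₂, h₁, h₂, rfl⟩ ⟨g', χ₁', χ₂', h₁', h₂', rfl⟩ b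
  obtain ⟨b₁, i₁⟩ := hα h₁ h₁' b
  obtain ⟨b₂, i₂⟩ := hβ h₂ h₂' b₁
  exact ⟨b₂, i₁.comp i₂⟩

theorem IsInduced.id_of_isFF (hW : ∀ ⦃x y : B⦄ (q : x ⟶ y), W q → IsFF q) {x y : B}
    (e : Zigzag W x y) : IsInduced hQ e e (𝟙 _) := by
  induction e with
  | id x =>
    rintro z a a' f f' χ χ' ⟨θ, rfl⟩ ⟨θ', rfl⟩ b
    exact ⟨_, .id θ θ' b⟩
  | of g => exact Q.map₂_id g ▸ isInduced_map₂ hQ (𝟙 g)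
  | inv q hq =>
    rintro z a a' f f' χ χ' ⟨θ, rfl⟩ ⟨θ', rfl⟩ b
    obtain ⟨b', hb⟩ := (hW q hq f f').2 (θ.hom ≫ b ≫ θ'.inv)
    exact ⟨b', .inv _ θ θ' hb⟩
  | comp e e' ih ih' => simpa [real] using ih.hcomp ih'

end Presentations

section Covers

variable {K : Type u} [Bicategory.{w, v} K] [Bicategory.Strict K] {S : StrictTwoSite K}
  {L : Type u'} [Bicategory.{w', v'} L] {Q : K ⥤ᵖ L}
  {hQ : Inverts (weakEquivalences S) Q}

theorem IsStandard.exists_snd {u x y z : K} {c : u ⟶ x} (hc : S.J c)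
    {e : Zigzag (weakEquivalences S) x y} {f : u ⟶ y} {χ : Presentation Q c (e.real hQ) f}
    (h : e.IsStandard hQ χ) (a : z ⟶ x) :
    ∃ (g : _) (ψ : Presentation Q (S.snd c hc a ≫ a) (e.real hQ) g), e.IsStandard hQ ψ := by
  rw [← (S.isPullback c hc a).w]
  exact ⟨_, _, h.restrict _⟩

variable (hQ) in
theorem exists_isStandard {x y : K} (e : Zigzag (weakEquivalences S) x y) :
    ∃ (u : K) (c : u ⟶ x) (f : u ⟶ y) (χ : Presentation Q c (e.real hQ) f),
      S.J c ∧ e.IsStandard hQ χ := by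
  induction e with
  | id x => exact ⟨x, 𝟙 x, _, _, S.id_mem x, Iso.refl _, rfl⟩
  | of g => exact ⟨_, 𝟙 _, _, _, S.id_mem _, Iso.refl _, rfl⟩
  | inv q hq =>
    obtain ⟨u, j, r, hj, ⟨θ⟩⟩ := hq.2
    exact ⟨u, j, r, _, hj, θ, rfl⟩
  | comp e e' ih ih' =>
    obtain ⟨u, c, f, χ, hc, h⟩ := ih
    obtain ⟨v, c', f', χ', hc', h'⟩ := ih'
    obtain ⟨g, ψ, hψ⟩ := h'.exists_snd hc' f
    exact ⟨_, _, g, _, S.comp_mem _ _ (S.snd_mem c' hc' f) hc, _, _, _, h.restrict _, hψ, rfl⟩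

theorem exists_intertwines_of_restrict (hQ : Inverts (weakEquivalences S) Q) {t x y z : K}
    {q : t ⟶ z} (hq : S.J q) {a a' : z ⟶ x} {h h' : Q.obj x ⟶ Q.obj y} {f f' : z ⟶ y}
    {χ : Presentation Q a h f} {χ' : Presentation Q a' h' f'} {b : a ⟶ a'} {α : h ⟶ h'}
    {b' : q ≫ f ⟶ q ≫ f'} (i : Intertwines (χ.restrict q) (χ'.restrict q) (q ◁ b) α b') :
    ∃ c : f ⟶ f', Intertwines χ χ' b α c := by
  obtain ⟨c, rfl, -⟩ := descent S hq b'
  exact ⟨c, i.of_restrict (hQ q (S.weakEquivalences_of_mem hq))⟩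

namespace IsInduced

variable {x y : K} {e e' e'' : Zigzag (weakEquivalences S) x y}

theorem id (e : Zigzag (weakEquivalences S) x y) : IsInduced hQ e e (𝟙 _) :=
  id_of_isFF (fun _ _ _ => And.left) e

theorem comp {α : e.real hQ ⟶ e'.real hQ} {α' : e'.real hQ ⟶ e''.real hQ}
    (hα : IsInduced hQ e e' α) (hα' : IsInduced hQ e' e'' α') : IsInduced hQ e e'' (α ≫ α') := by
  intro z a a' f f' χ χ' h h' b
  obtain ⟨u, c, g, ω, hc, hω⟩ := exists_isStandard hQ e'
  obtain ⟨g', ψ, hψ⟩ := hω.exists_snd hc a'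
  obtain ⟨b₁, i₁⟩ := hα (h.restrict _) hψ (S.snd c hc a' ◁ b)
  obtain ⟨b₂, i₂⟩ := hα' hψ (h'.restrict _) (𝟙 _)
  exact exists_intertwines_of_restrict hQ (S.snd_mem c hc a')
    (b' := b₁ ≫ b₂) (by simpa using i₁.trans i₂)

/-- Over the pullback of the cover `c`, any standard presentation can be compared with the given
one. -/
theorem of_intertwines {u : K} {c : u ⟶ x} (hc : S.J c) {f f' : u ⟶ y}
    {χ : Presentation Q c (e.real hQ) f} {χ' : Presentation Q c (e'.real hQ) f'}
    (h : e.IsStandard hQ χ) (h' : e'.IsStandard hQ χ') {α : e.real hQ ⟶ e'.real hQ} {b : f ⟶ f'}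
    (i : Intertwines χ χ' (𝟙 c) α b) : IsInduced hQ e e' α := by
  intro z a a' g g' ψ ψ' k k' b₀
  let p := S.fst c hc a'
  let q := S.snd c hc a'
  have hq : S.J q := S.snd_mem c hc a'
  have w : p ≫ c = q ≫ a' := (S.isPullback c hc a').w
  obtain ⟨b₁, i₁⟩ := IsInduced.id e (k.restrict q) (h.restrict p) (q ◁ b₀ ≫ eqToHom w.symm)
  obtain ⟨b₂, i₂⟩ := IsInduced.id e' (h'.restrict p) (k'.restrict q) (eqToHom w)
  exact exists_intertwines_of_restrict hQ hq
    (b' := (b₁ ≫ p ◁ b) ≫ b₂) (by simpa using (i₁.trans (i.restrict p)).trans i₂)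

theorem whiskerLeft {z : K} (k : Zigzag (weakEquivalences S) z x) {α : e.real hQ ⟶ e'.real hQ}
    (h : IsInduced hQ e e' α) : IsInduced hQ (k.comp e) (k.comp e') (k.real hQ ◁ α) := by
  simpa [real] using (IsInduced.id k).hcomp h

theorem whiskerRight {z : K} (k : Zigzag (weakEquivalences S) y z) {α : e.real hQ ⟶ e'.real hQ}
    (h : IsInduced hQ e e' α) : IsInduced hQ (e.comp k) (e'.comp k) (α ▷ k.real hQ) := by
  simpa [real] using h.hcomp (IsInduced.id k)

theorem exists_map₂_eq {f g : x ⟶ y} {α : Q.map f ⟶ Q.map g}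
    (h : IsInduced hQ (of f) (of g) α) : ∃ c : f ⟶ g, Q.map₂ c = α := by
  obtain ⟨c, i⟩ := h (χ := .of (λ_ f)) (χ' := .of (λ_ g)) ⟨_, rfl⟩ ⟨_, rfl⟩ (𝟙 (𝟙 x))
  exact ⟨c, Intertwines.unique (hQ _ (S.weakEquivalences_of_mem (S.id_mem x)))
    (by simpa using Intertwines.of (Q := Q) (λ_ f) (λ_ g) (𝟙 (𝟙 x)) c) i⟩

end IsInduced

/-- The isomorphism `α` between the composites of two zigzags identifies standard presentations of
both by one and the same fraction. All constraint isomorphisms are of this kind. -/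
def HasCommonPresentation (hQ : Inverts (weakEquivalences S) Q) {x y : K}
    (e e' : Zigzag (weakEquivalences S) x y) (α : e.real hQ ≅ e'.real hQ) : Prop :=
  ∃ (u : K) (c : u ⟶ x) (f : u ⟶ y) (χ : Presentation Q c (e.real hQ) f)
    (χ' : Presentation Q c (e'.real hQ) f),
    S.J c ∧ e.IsStandard hQ χ ∧ e'.IsStandard hQ χ' ∧ χ.hom = Q.map c ◁ α.hom ≫ χ'.hom

namespace HasCommonPresentation

variable {x y z t : K}

theorem isInduced_hom {e e' : Zigzag (weakEquivalences S) x y} {α : e.real hQ ≅ e'.real hQ}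
    (h : HasCommonPresentation hQ e e' α) : IsInduced hQ e e' α.hom := by
  obtain ⟨u, c, f, χ, χ', hc, hχ, hχ', w⟩ := h
  exact .of_intertwines hc hχ hχ' (b := 𝟙 f) (by simp [Intertwines, w])

theorem symm {e e' : Zigzag (weakEquivalences S) x y} {α : e.real hQ ≅ e'.real hQ}
    (h : HasCommonPresentation hQ e e' α) : HasCommonPresentation hQ e' e α.symm := by
  obtain ⟨u, c, f, χ, χ', hc, hχ, hχ', w⟩ := h
  exact ⟨u, c, f, χ', χ, hc, hχ', hχ, by simp [w]⟩

theorem of_isStandard {e : Zigzag (weakEquivalences S) x y} {c : t ⟶ x} {f : t ⟶ y}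
    {χ : Presentation Q c (e.real hQ) f} (h : e.IsStandard hQ χ) :
    HasCommonPresentation hQ ((of c).comp e) (of f) χ :=
  ⟨t, 𝟙 t, 𝟙 t ≫ f, (Presentation.of (Iso.refl _)).comp (χ.restrict (𝟙 t)), .of (Iso.refl _),
    S.id_mem t, ⟨_, _, _, ⟨_, rfl⟩, h.restrict _, rfl⟩, ⟨_, rfl⟩, by simp [real]⟩

variable (hQ)

theorem associator (e : Zigzag (weakEquivalences S) x y) (k : Zigzag (weakEquivalences S) y z)
    (l : Zigzag (weakEquivalences S) z t) :
    HasCommonPresentation hQ ((e.comp k).comp l) (e.comp (k.comp l)) (α_ _ _ _) := by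
  obtain ⟨u, c, f, _, hc, _, χ₁, _, h₁, ⟨_, χ₂, χ₃, h₂, h₃, rfl⟩, rfl⟩ :=
    exists_isStandard hQ (e.comp (k.comp l))
  exact ⟨u, c, f, (χ₁.comp χ₂).comp χ₃, χ₁.comp (χ₂.comp χ₃), hc,
    ⟨_, _, _, ⟨_, _, _, h₁, h₂, rfl⟩, h₃, rfl⟩, ⟨_, _, _, h₁, ⟨_, _, _, h₂, h₃, rfl⟩, rfl⟩,
    by simp [real]⟩

theorem leftUnitor (e : Zigzag (weakEquivalences S) x y) :
    HasCommonPresentation hQ ((id x).comp e) e (λ_ _) := by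
  obtain ⟨u, c, f, χ, hc, h⟩ := exists_isStandard hQ e
  exact ⟨u, c, f, (Presentation.id (Iso.refl c)).comp χ, χ, hc,
    ⟨_, _, _, ⟨_, rfl⟩, h, rfl⟩, h, by simp [real]⟩

theorem rightUnitor (e : Zigzag (weakEquivalences S) x y) :
    HasCommonPresentation hQ (e.comp (id y)) e (ρ_ _) := by
  obtain ⟨u, c, f, χ, hc, h⟩ := exists_isStandard hQ e
  exact ⟨u, c, f, χ.comp (.id (Iso.refl f)), χ, hc,
    ⟨_, _, _, h, ⟨_, rfl⟩, rfl⟩, h, by simp [real]⟩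

theorem mapId (x : K) : HasCommonPresentation hQ (of (𝟙 x)) (id x) (Q.mapId x) :=
  ⟨x, 𝟙 x, 𝟙 x, .of (ρ_ _), .id (Iso.refl _), S.id_mem x, ⟨_, rfl⟩, ⟨_, rfl⟩, by simp [real]⟩

theorem mapComp (f : x ⟶ y) (g : y ⟶ z) :
    HasCommonPresentation hQ (of (f ≫ g)) ((of f).comp (of g)) (Q.mapComp f g) :=
  ⟨x, 𝟙 x, 𝟙 x ≫ f ≫ g, .of (Iso.refl _), (Presentation.of (Iso.refl _)).comp (.of (α_ _ _ _)),
    S.id_mem x,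
    ⟨_, rfl⟩, ⟨_, _, _, ⟨_, rfl⟩, ⟨_, rfl⟩, rfl⟩, by simp [real]⟩

theorem unit (q : x ⟶ y) (hq : weakEquivalences S q) :
    HasCommonPresentation hQ (id x) ((of q).comp (inv q hq)) (hQ q hq).unit :=
  ⟨x, 𝟙 x, 𝟙 x, .id (Iso.refl _), (Presentation.of (Iso.refl _)).comp (.inv _ (Iso.refl _)),
    S.id_mem x, ⟨_, rfl⟩, ⟨_, _, _, ⟨_, rfl⟩, ⟨_, rfl⟩, rfl⟩, by simp [real]⟩

theorem counit (q : x ⟶ y) (hq : weakEquivalences S q) :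
    HasCommonPresentation hQ ((inv q hq).comp (of q)) (id y) (hQ q hq).counit := by
  obtain ⟨u, j, r, hj, ⟨θ⟩⟩ := hq.2
  have h := (hQ q hq).whiskerRight_comp_counit (Q.map₂ θ.inv ≫ (Q.mapComp r q).hom)
  refine ⟨u, j, j, (Presentation.inv (hQ q hq) θ).comp (.of θ), .id (Iso.refl _), hj,
    ⟨_, _, _, ⟨_, rfl⟩, ⟨_, rfl⟩, rfl⟩, ⟨_, rfl⟩, ?_⟩
  simp only [Presentation.comp_hom, Presentation.inv_hom, Presentation.of_hom, real]
  rw [reassoc_of% h]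
  simp

end HasCommonPresentation

end Covers

end Zigzag

section ZigzagBicat

variable {K : Type u} [Bicategory.{w, v} K] [Bicategory.Strict K] {S : StrictTwoSite K}
  {L : Type u'} [Bicategory.{w', v'} L] {Q : K ⥤ᵖ L}

/-- The bicategory with the objects of `K`, zigzags in `K` as 1-arrows and the induced 2-arrows of
`L` as 2-arrows: it has the 1-arrows of a localisation of `K`, but only those 2-arrows that come
from `K`. The universe levels leave room for `L` to be embedded into bicategories of the same
size. -/
structure ZigzagBicat (hQ : Inverts (weakEquivalences S) Q) : Type (max u u') where
  /-- The underlying object of `K`. -/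
  obj : K

namespace ZigzagBicat

variable {hQ : Inverts (weakEquivalences S) Q}

/-- The 1-arrows of `ZigzagBicat hQ`. -/
structure Hom (X Y : ZigzagBicat hQ) : Type (max u v v') where
  /-- The underlying zigzag. -/
  zigzag : Zigzag (weakEquivalences S) X.obj Y.obj

/-- The composite of a 1-arrow of `ZigzagBicat hQ` in `L`. -/
noncomputable abbrev Hom.real {X Y : ZigzagBicat hQ} (f : Hom X Y) : Q.obj X.obj ⟶ Q.obj Y.obj :=
  f.zigzag.real hQ

/-- The 2-arrows of `ZigzagBicat hQ`. -/
@[ext]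
structure Hom₂ {X Y : ZigzagBicat hQ} (f g : Hom X Y) : Type (max w w') where
  /-- The underlying 2-arrow of `L`. -/
  cell : f.real ⟶ g.real
  isInduced : f.zigzag.IsInduced hQ g.zigzag cell

noncomputable instance : CategoryStruct (ZigzagBicat hQ) where
  Hom := Hom
  id X := ⟨.id X.obj⟩
  comp f g := ⟨f.zigzag.comp g.zigzag⟩

noncomputable instance (X Y : ZigzagBicat hQ) : Category (X ⟶ Y) where
  Hom := Hom₂
  id f := ⟨𝟙 f.real, Zigzag.IsInduced.id f.zigzag⟩
  comp a b := ⟨a.cell ≫ b.cell, a.isInduced.comp b.isInduced⟩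
  id_comp _ := Hom₂.ext (Category.id_comp _)
  comp_id _ := Hom₂.ext (Category.comp_id _)
  assoc _ _ _ := Hom₂.ext (Category.assoc _ _ _)

/-- The invertible 2-arrow of `ZigzagBicat hQ` given by an isomorphism that identifies standard
presentations. -/
def isoMk {X Y : ZigzagBicat hQ} {f g : X ⟶ Y} (α : Hom.real f ≅ Hom.real g)
    (h : Zigzag.HasCommonPresentation hQ f.zigzag g.zigzag α) : f ≅ g where
  hom := ⟨α.hom, h.isInduced_hom⟩
  inv := ⟨α.inv, h.symm.isInduced_hom⟩
  hom_inv_id := Hom₂.ext α.hom_inv_id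
  inv_hom_id := Hom₂.ext α.inv_hom_id

noncomputable instance bicategory : Bicategory (ZigzagBicat hQ) where
  homCategory _ _ := inferInstance
  whiskerLeft f _ _ (a : Hom₂ _ _) :=
    Hom₂.mk (Hom.real f ◁ a.cell) (a.isInduced.whiskerLeft f.zigzag)
  whiskerRight (a : Hom₂ _ _) f :=
    Hom₂.mk (a.cell ▷ Hom.real f) (a.isInduced.whiskerRight f.zigzag)
  associator f g h := isoMk (α_ (Hom.real f) (Hom.real g) (Hom.real h)) (.associator hQ _ _ _)
  leftUnitor f := isoMk (λ_ (Hom.real f)) (.leftUnitor hQ _)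
  rightUnitor f := isoMk (ρ_ (Hom.real f)) (.rightUnitor hQ _)
  whiskerLeft_id _ _ := Hom₂.ext (whiskerLeft_id _ _)
  whiskerLeft_comp _ _ _ _ _ _ := Hom₂.ext (whiskerLeft_comp _ _ _)
  id_whiskerLeft _ := Hom₂.ext (id_whiskerLeft _)
  comp_whiskerLeft _ _ _ _ _ := Hom₂.ext (comp_whiskerLeft _ _ _)
  id_whiskerRight _ _ := Hom₂.ext (id_whiskerRight _ _)
  comp_whiskerRight _ _ _ := Hom₂.ext (comp_whiskerRight _ _ _)
  whiskerRight_id _ := Hom₂.ext (whiskerRight_id _)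
  whiskerRight_comp _ _ _ := Hom₂.ext (whiskerRight_comp _ _ _)
  whisker_assoc _ _ _ _ _ := Hom₂.ext (whisker_assoc _ _ _)
  whisker_exchange _ _ := Hom₂.ext (whisker_exchange _ _)
  pentagon _ _ _ _ := Hom₂.ext (pentagon _ _ _ _)
  triangle _ _ := Hom₂.ext (triangle _ _)

variable (hQ)

/-- The 1-arrow of `ZigzagBicat hQ` given by a zigzag. -/
abbrev mkHom {x y : K} (e : Zigzag (weakEquivalences S) x y) :
    (⟨x⟩ : ZigzagBicat hQ) ⟶ ⟨y⟩ :=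
  Hom.mk e

/-- The canonical pseudofunctor from `K` to `ZigzagBicat hQ`. -/
noncomputable def ofBase : K ⥤ᵖ ZigzagBicat hQ where
  obj x := ⟨x⟩
  map f := mkHom hQ (.of f)
  map₂ a := Hom₂.mk (Q.map₂ a) (Zigzag.isInduced_map₂ hQ a)
  map₂_id _ := Hom₂.ext (Q.map₂_id _)
  map₂_comp _ _ := Hom₂.ext (Q.map₂_comp _ _)
  mapId x := isoMk (f := mkHom hQ _) (g := mkHom hQ _) (Q.mapId x) (.mapId hQ x)
  mapComp f g := isoMk (f := mkHom hQ _) (g := mkHom hQ _) (Q.mapComp f g) (.mapComp hQ f g)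
  map₂_whisker_left _ _ _ _ := Hom₂.ext (Q.map₂_whisker_left _ _)
  map₂_whisker_right _ _ := Hom₂.ext (Q.map₂_whisker_right _ _)
  map₂_associator _ _ _ := Hom₂.ext (Q.map₂_associator _ _ _)
  map₂_left_unitor _ := Hom₂.ext (Q.map₂_left_unitor _)
  map₂_right_unitor _ := Hom₂.ext (Q.map₂_right_unitor _)

theorem inverts_ofBase : Inverts (weakEquivalences S) (ofBase hQ) := fun x y q hq =>
  ⟨mkHom hQ (.inv q hq),
    ⟨(isoMk (f := mkHom hQ (.id x)) (g := mkHom hQ (.comp (.of q) (.inv q hq)))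
      (hQ q hq).unit (.unit hQ q hq)).symm⟩,
    ⟨isoMk (f := mkHom hQ (.comp (.inv q hq) (.of q))) (g := mkHom hQ (.id y))
      (hQ q hq).counit (.counit hQ q hq)⟩⟩

instance full_mapFunctor_ofBase (x y : K) : ((ofBase hQ).mapFunctor x y).Full where
  map_surjective {f g} (a : Hom₂ _ _) := by
    obtain ⟨c, hc⟩ := Zigzag.IsInduced.exists_map₂_eq a.isInduced
    exact ⟨c, Hom₂.ext hc⟩

theorem exists_presentation_ofBase {x y : K} (f : (ofBase hQ).obj x ⟶ (ofBase hQ).obj y) :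
    ∃ (u : K) (j : u ⟶ x) (d : u ⟶ y), S.J j ∧ Nonempty (Presentation (ofBase hQ) j f d) := by
  obtain ⟨u, c, d, χ, hc, h⟩ := Zigzag.exists_isStandard hQ f.zigzag
  exact ⟨u, c, d, hc, ⟨isoMk (f := mkHom hQ _) (g := mkHom hQ _) χ (.of_isStandard h)⟩⟩

theorem locallyEssentiallySmall (hK : LocallyEssentiallySmall.{s} K) (hW : WISC.{s} S) :
    LocallyEssentiallySmall.{s} (ZigzagBicat hQ) := fun X Y =>
  essentiallySmall_hom_of_presentations hK hW
    (fun _ _ _ hj => inverts_ofBase hQ _ (S.weakEquivalences_of_mem hj)) X.obj Y.obj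
    (exists_presentation_ofBase hQ)

/-- The forgetful pseudofunctor, which sends a zigzag to its composite in `L`. -/
noncomputable def forget : ZigzagBicat hQ ⥤ᵖ L :=
  (StrictPseudofunctor.mk'
    { obj X := Q.obj X.obj
      map f := Hom.real f
      map₂ a := Hom₂.cell a
      map₂_id _ := rfl
      map₂_comp _ _ := rfl
      map_id _ := rfl
      map_comp _ _ := rfl
      map₂_whisker_left _ _ _ _ := ((Category.id_comp _).trans (Category.comp_id _)).symm
      map₂_whisker_right _ _ := ((Category.id_comp _).trans (Category.comp_id _)).symm
      map₂_left_unitor _ := (Category.id_comp _).symm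
      map₂_right_unitor _ := (Category.id_comp _).symm
      map₂_associator _ _ _ := ((Category.id_comp _).trans (Category.comp_id _)).symm
      }).toPseudofunctor

theorem ofBase_comp_forget : (ofBase hQ).comp (forget hQ) = Q :=
  pseudofunctor_ext rfl
    (heq_of_eq (funext fun _ => Iso.ext (Category.comp_id _)))
    (heq_of_eq (funext₃ fun _ _ _ => funext₂ fun _ _ => Iso.ext (Category.comp_id _)))

end ZigzagBicat

end ZigzagBicat

namespace IsLocalisation

variable {K : Type u} [Bicategory.{w, v} K] [Bicategory.Strict K] {S : StrictTwoSite K}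
  {L : Type u'} [Bicategory.{w', v'} L] {Q : K ⥤ᵖ L}

open scoped Pseudofunctor.StrongTrans

theorem locallyEssentiallySmall
    (h : IsLocalisation.{max u u', max u v v', max w w'} (weakEquivalences S) Q)
    (hK : LocallyEssentiallySmall.{s} K) (hW : WISC.{s} S) : LocallyEssentiallySmall.{s} L := by
  obtain ⟨hQ, h⟩ := h
  let A := ULiftBicat L (ZigzagBicat hQ)
  let lift : L ⥤ᵖ A := ULiftBicat.up L (ZigzagBicat hQ)
  let forget : ZigzagBicat hQ ⥤ᵖ A := (ZigzagBicat.forget hQ).comp lift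
  obtain ⟨G, ⟨e⟩⟩ :=
    (h (ZigzagBicat hQ)).1 ⟨ZigzagBicat.ofBase hQ, ZigzagBicat.inverts_ofBase hQ⟩
  have retract_on_base : IsPseudoretract (Q.comp lift) (Q.comp (G.comp forget)) := by
    have : IsPseudoretract ((ZigzagBicat.ofBase hQ).comp forget) ((Q.comp G).comp forget) :=
      (isPseudoretract_inducedBicategory_iff.1 (.of_equivalence e)).postcomp forget
    rwa [← pseudofunctor_comp_assoc, ZigzagBicat.ofBase_comp_forget,
      pseudofunctor_comp_assoc] at this
  have := (h A).2
  have retract : IsPseudoretract lift (G.comp forget) :=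
    .of_map (precomposition hQ A) (isPseudoretract_inducedBicategory_iff.2 retract_on_base)
  exact retract.locallyEssentiallySmall (ZigzagBicat.locallyEssentiallySmall hQ hK hW)

end IsLocalisation

end TwoSite

theorem mainTheorem5 {K : Type u} [Bicategory.{w, v} K] [Bicategory.Strict K]
    (S : TwoSite.StrictTwoSite K)
    (hK : TwoSite.LocallyEssentiallySmall.{s} K)
    (hW : TwoSite.WISC.{s} S) :
    TwoSite.FractionsLocallyEssentiallySmall.{s} S ∧
      ∀ (L : Type u') [Bicategory.{w', v'} L] (Q : K ⥤ᵖ L),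
        TwoSite.IsLocalisation.{max u u', max u v v', max w w'}
          (TwoSite.weakEquivalences S) Q →
        TwoSite.LocallyEssentiallySmall.{s} L :=
  ⟨TwoSite.Fraction.essentiallySmall hK hW,
    fun _ _ _ hQ => TwoSite.IsLocalisation.locallyEssentiallySmall hQ hK hW⟩
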